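/- Consider formulas $A,B ::= \bot \mid p_n \mid \neg A \mid A\wedge B \mid A\Rightarrow B$ over countably many propositional variables $p_0,p_1,\dots$, with the usual abbreviations $\top=\neg\bot$, $A\vee B=\neg(\neg A\wedge\neg B)$, $A\to B=\neg(A\wedge\neg B)$ and $A\leftrightarrow B=(A\to B)\wedge(B\to A)$. For a set $R$ of rules, the $R$-provable formulas form the least set that contains all substitution instances of propositional tautologies and is closed under modus ponens (from $A$ and $A\to B$ infer $B$) and under the rules in $R$. Let $\mathsf{CK}$ consist of all instances of $$(\mathsf{RCEA})\ \frac{A\leftrightarrow A'}{(A\Rightarrow B)\leftrightarrow(A'\Rightarrow B)}\qquad (\mathsf{RCK})\ \frac{B_1\wedge\dots\wedge B_n\to B}{(A\Rightarrow B_1)\wedge\dots\wedge(A\Rightarrow B_n)\to(A\Rightarrow B)}\quad(n\ge 0),$$ where the empty conjunction is $\top$. Let $\mathsf{CKMPCEM}$ extend $\mathsf{CK}$ by all instances of the axioms $(\mathsf{MP})$ $(A\Rightarrow B)\to(A\to B)$ and $(\mathsf{CEM})$ $(A\Rightarrow B)\vee(A\Rightarrow\neg B)$, and let $\mathsf{CKIDMPCEM}$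 extend $\mathsf{CKMPCEM}$ by all instances of the axiom $(\mathsf{ID})$ $A\Rightarrow A$. Theorem. Provability in $\mathsf{CKMPCEM}$ and provability in $\mathsf{CKIDMPCEM}$ are in PSPACE. That is, for each of these two logics, the set of words coding provable formulas (formulas being written in prefix notation over a finite alphabet, with variable indices in binary) is decided by a deterministic Turing machine that halts on every input and uses space bounded by a polynomial in the length of the input. -/

import Mathlib

/-! ### The language of conditional logic -/

/-- Formulas of conditional logic over the propositional variables `p₀, p₁, p₂, …`:
`A, B ::= ⊥ | p | ¬A | A ∧ B | A ⇒ B`. -/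
inductive Form : Type
  | bot : Form
  | var : ℕ → Form
  | neg : Form → Form
  | and : Form → Form → Form
  | cond : Form → Form → Form

namespace Form

/-- `⊤` abbreviates `¬⊥`. -/
def top : Form := neg bot

/-- `A ∨ B` abbreviates `¬(¬A ∧ ¬B)`. -/
def or (A B : Form) : Form := neg (and (neg A) (neg B))

/-- `A → B` abbreviates `¬(A ∧ ¬B)`. -/
def imp (A B : Form) : Form := neg (and A (neg B))

/-- `A ↔ B` abbreviates `(A → B) ∧ (B → A)`. -/
def iff (A B : Form) : Form := and (imp A B) (imp B A)

/-- Finite conjunctions `A₁ ∧ ⋯ ∧ Aₙ`; the empty conjunction is `⊤`. -/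
def conj : List Form → Form
  | [] => top
  | [A] => A
  | A :: B :: l => and A (conj (B :: l))

end Form

/-! ### Propositional tautologies -/

/-- Purely propositional formulas. -/
inductive PropForm : Type
  | bot : PropForm
  | var : ℕ → PropForm
  | neg : PropForm → PropForm
  | and : PropForm → PropForm → PropForm

namespace PropForm

/-- Classical truth value under a valuation. -/
def eval (v : ℕ → Bool) : PropForm → Bool
  | bot => false
  | var n => v n
  | neg A => !(eval v A)
  | and A B => eval v A && eval v B

/-- Propositional tautologies. -/
def IsTautology (A : PropForm) : Prop := ∀ v : ℕ → Bool, A.eval v = true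

/-- The result `Aσ` of uniformly substituting `σ n` for the `n`-th variable. -/
def subst (σ : ℕ → Form) : PropForm → Form
  | bot => Form.bot
  | var n => σ n
  | neg A => Form.neg (subst σ A)
  | and A B => Form.and (subst σ A) (subst σ B)

end PropForm

/-! ### Hilbert systems -/

/-- A rule (a concrete instance, not a schema) with finitely many premises; an axiom is a rule
without premises. -/
structure Rule : Type where
  premises : List Form
  conclusion : Form

/-- Derivability `H R ⊢ A` in the Hilbert system induced by a rule set `R`: the least set of
formulas containing all substitution instances of propositional tautologies and closed under
modus ponens and under the rules in `R`. -/
inductive HilbertDerivable (R : Set Rule) : Form → Prop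
  | taut (A : PropForm) (σ : ℕ → Form) (hA : A.IsTautology) : HilbertDerivable R (A.subst σ)
  | mp (A B : Form) (hA : HilbertDerivable R A) (hAB : HilbertDerivable R (A.imp B)) :
      HilbertDerivable R B
  | rule (r : Rule) (hr : r ∈ R) (hp : ∀ A ∈ r.premises, HilbertDerivable R A) :
      HilbertDerivable R r.conclusion

/-- All instances of `(RCEA)`: from `A ↔ A'` infer `(A ⇒ B) ↔ (A' ⇒ B)`. -/
def RCEA : Set Rule :=
  {r | ∃ A A' B : Form, r = ⟨[A.iff A'], (A.cond B).iff (A'.cond B)⟩}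

/-- All instances of `(RCK)`, for `n ≥ 0`:
from `B₁ ∧ ⋯ ∧ Bₙ → B` infer `(A ⇒ B₁) ∧ ⋯ ∧ (A ⇒ Bₙ) → (A ⇒ B)`. -/
def RCK : Set Rule :=
  {r | ∃ (A B : Form) (Bs : List Form),
    r = ⟨[(Form.conj Bs).imp B], (Form.conj (Bs.map (fun C => A.cond C))).imp (A.cond B)⟩}

/-- All instances of the axiom `(ID)`: `A ⇒ A`. -/
def axID : Set Rule := {r | ∃ A : Form, r = ⟨[], A.cond A⟩}

/-- All instances of the axiom `(MP)`: `(A ⇒ B) → (A → B)`. -/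
def axMP : Set Rule := {r | ∃ A B : Form, r = ⟨[], (A.cond B).imp (A.imp B)⟩}

/-- All instances of the axiom `(CEM)`: `(A ⇒ B) ∨ (A ⇒ ¬B)`. -/
def axCEM : Set Rule := {r | ∃ A B : Form, r = ⟨[], (A.cond B).or (A.cond B.neg)⟩}

/-- The rule set of the basic conditional logic `CK`. -/
def CK : Set Rule := RCEA ∪ RCK

/-- The rule set of `CKMPCEM`. -/
def CKMPCEM : Set Rule := CK ∪ axMP ∪ axCEM

/-- The rule set of `CKIDMPCEM`. -/
def CKIDMPCEM : Set Rule := CK ∪ axID ∪ axMP ∪ axCEM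

/-! ### Formulas as words over a finite alphabet -/

/-- The finite alphabet in which formulas are written. -/
inductive Letter : Type
  | bot
  | neg
  | and
  | cond
  | var
  | bit (b : Bool)

/-- Formulas in prefix notation; the variable `pₙ` is written as the binary digits of `n`
(least significant first) followed by the symbol `Letter.var`. -/
def Form.code : Form → List Letter
  | .bot => [Letter.bot]
  | .var n => n.bits.map Letter.bit ++ [Letter.var]
  | .neg A => Letter.neg :: A.code
  | .and A B => Letter.and :: (A.code ++ B.code)
  | .cond A B => Letter.cond :: (A.code ++ B.code)

theorem bits_append_var_cancel : ∀ (l l' : List Bool) (r r' : List Letter),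
    l.map Letter.bit ++ Letter.var :: r = l'.map Letter.bit ++ Letter.var :: r' → l = l' ∧ r = r'
  | [], [], _, _, h => by simpa using h
  | [], _ :: _, _, _, h => by simp at h
  | _ :: _, [], _, _, h => by simp at h
  | a :: l, b :: l', r, r', h => by
    simp only [List.map_cons, List.cons_append, List.cons.injEq, Letter.bit.injEq] at h
    obtain ⟨h1, h2⟩ := bits_append_var_cancel l l' r r' h.2
    exact ⟨by rw [h.1, h1], h2⟩

theorem bits_append_var_eq_cons (l : List Bool) (r t : List Letter) (s : Letter)
    (h : l.map Letter.bit ++ Letter.var :: r = s :: t) : s = Letter.var ∨ ∃ b, s = Letter.bit b := by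
  cases l with
  | nil => simp at h; exact Or.inl h.1.symm
  | cons b l => simp at h; exact Or.inr ⟨b, h.1.symm⟩

/-- The notation is uniquely readable. -/
theorem Form.code_append_cancel (A : Form) : ∀ (B : Form) (r s : List Letter),
    A.code ++ r = B.code ++ s → A = B ∧ r = s := by
  induction A with
  | bot =>
    intro B r s h
    cases B with
    | var n =>
      have := bits_append_var_eq_cons n.bits s r Letter.bot (by simpa [code] using h.symm)
      simp at this
    | _ => simp_all [code]
  | var n =>
    intro B r s h
    cases B with
    | var m =>
      have h' := bits_append_var_cancel n.bits m.bits r s (by simpa [code] using h)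
      refine ⟨?_, h'.2⟩
      have hb := congrArg (fun l => l.foldr Nat.bit 0) h'.1
      have key : ∀ k : ℕ, k.bits.foldr Nat.bit 0 = k := by
        intro k
        induction k using Nat.binaryRec' with
        | zero => simp
        | bit b k hk ih => rw [Nat.bits_append_bit k b hk]; simp [ih]
      simp only [key] at hb
      rw [hb]
    | bot =>
      have := bits_append_var_eq_cons n.bits r _ _ (by simpa [code] using h)
      simp at this
    | neg =>
      have := bits_append_var_eq_cons n.bits r _ _ (by simpa [code] using h)
      simp at this
    | and =>
      have := bits_append_var_eq_cons n.bits r _ _ (by simpa [code] using h)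
      simp at this
    | cond =>
      have := bits_append_var_eq_cons n.bits r _ _ (by simpa [code] using h)
      simp at this
  | neg A ih =>
    intro B r s h
    cases B with
    | var n =>
      have := bits_append_var_eq_cons n.bits s _ _ (by simpa [code] using h.symm)
      simp at this
    | neg B =>
      have := ih B r s (by simpa [code] using h)
      exact ⟨by rw [this.1], this.2⟩
    | _ => simp [code] at h
  | and A₁ A₂ ih₁ ih₂ =>
    intro B r s h
    cases B with
    | var n =>
      have := bits_append_var_eq_cons n.bits s _ _ (by simpa [code] using h.symm)
      simp at this
    | and B₁ B₂ =>
      have h1 := ih₁ B₁ (A₂.code ++ r) (B₂.code ++ s) (by simpa [code] using h)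
      have h2 := ih₂ B₂ r s h1.2
      exact ⟨by rw [h1.1, h2.1], h2.2⟩
    | _ => simp [code] at h
  | cond A₁ A₂ ih₁ ih₂ =>
    intro B r s h
    cases B with
    | var n =>
      have := bits_append_var_eq_cons n.bits s _ _ (by simpa [code] using h.symm)
      simp at this
    | cond B₁ B₂ =>
      have h1 := ih₁ B₁ (A₂.code ++ r) (B₂.code ++ s) (by simpa [code] using h)
      have h2 := ih₂ B₂ r s h1.2
      exact ⟨by rw [h1.1, h2.1], h2.2⟩
    | _ => simp [code] at h

theorem Form.code_injective : Function.Injective Form.code := fun A B h =>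
  (Form.code_append_cancel A B [] [] (by rw [h])).1

/-- The provability problem of the Hilbert system induced by `R`, as a formal language: the set of
all words that code an `R`-derivable formula. -/
def provabilityProblem (R : Set Rule) : Set (List Letter) :=
  {w | ∃ A : Form, HilbertDerivable R A ∧ w = A.code}

/-! ### Polynomial space -/

/-- The space used by a configuration of a multi-stack Turing machine: the total number of symbols
on all of its stacks (including the input stack). -/
def spaceUsed (tm : Turing.FinTM2) (c : tm.Cfg) : ℕ :=
  letI := tm.kFin
  ∑ k : tm.K, (c.stk k).length

/-- `L` is in `PSPACE`: some deterministic Turing machine (finitely many stacks, finite alphabets,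
finitely many states and labels) halts on every input word `w` with the one-symbol output `true`
or `false` according to whether `w ∈ L`, and during the whole computation uses space polynomially
bounded in the length of `w`. -/
def InPSPACE {α : Type} (L : Set (List α)) : Prop :=
  ∃ (M : Turing.TM2ComputableAux α Bool) (p : Polynomial ℕ),
    (∀ k, Finite (M.tm.Γ k)) ∧
    ∀ w : List α,
      (∃ b : Bool, (b = true ↔ w ∈ L) ∧
        Nonempty (Turing.TM2Outputs M.tm (w.map M.inputAlphabet.symm)
          (some [M.outputAlphabet.symm b]))) ∧
      ∀ c : M.tm.Cfg,
        StateTransition.Reaches M.tm.step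
          (Turing.initList M.tm (w.map M.inputAlphabet.symm)) c →
        spaceUsed M.tm c ≤ p.eval w.length

/-! Maximal consistent sets are handled as characteristic functions `v` (`IsUltra`). By compactness
a formula is provable iff it is true in all of them (`exists_isUltra_of_not_derivable`). MP and CEM
make these sets rigid. If `A` is true in `v`, then `A ⇒ B` has the value of `B`
(`IsUltra.cond_of_true`). If `A ⇒ ⊥` is true, so is every `A ⇒ B`. If `A ⇒ ⊥` is false, then `B ↦ v
(A ⇒ B)` is again maximal consistent (`IsUltra.successor`), and under ID it contains `A`.
Conversely, values for the variables and at most one successor for each class of provably equivalent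
antecedents always assemble into a new maximal consistent set (`isUltra_rootVal`). Satisfiability is
therefore a search for successors, except that one must know which antecedents are provably
equivalent, which is itself a provability question.

A game settles both questions together. A type labels the subformula occurrences of `φ` by truth
values. In a round at the type `t` the challenger marks a formula (`x`), the defender claims a set
of conditionals, meant to be those whose antecedents are equivalent to it (`y`), the challenger may
dispute an omission (`z`), and the defender produces the next type `u`. After a dispute `u` must
separate the two formulas. Otherwise `u` must be a successor for all claimed conditionals, or these
must all be true in `t`. Claiming too much only binds the defender further, so only omissions can be
disputed. The same moves check that all occurrences of a variable carry one value: `x` spells its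
name, `y` announces its value, `z` selects an occurrence.

Labels taken from a maximal consistent set survive every round (`round_sound`). Labels that survive
`k` rounds agree with some maximal consistent set on subformulas of depth less than `k`
(`round_complete`). Depth is smaller than length, so as many rounds as the word has letters decide
provability (`derivable_iff_sat`).

A round is won or lost according to one right-to-left scan of the labelled word with a stack
(`Scan.verdict_code`). A play consists of quadratically many quantified bits, and depth-first
evaluation with the bits kept on stacks needs space linear in their number (`Reach.search`,
`Reach.halts`). -/

set_option linter.unusedSimpArgs false

/-! ### Propositional reasoning -/

/-- A truth assignment to all formulas that respects the Boolean connectives. -/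
structure IsBoolHom (v : Form → Bool) : Prop where
  bot : v .bot = false
  neg : ∀ A, v (.neg A) = !v A
  and : ∀ A B, v (.and A B) = (v A && v B)

namespace IsBoolHom

variable {v : Form → Bool} (h : IsBoolHom v)
include h

theorem imp (A B : Form) : v (A.imp B) = (!v A || v B) := by
  simp [Form.imp, h.neg, h.and]

theorem or (A B : Form) : v (A.or B) = (v A || v B) := by
  simp [Form.or, h.neg, h.and]

theorem iff (A B : Form) : v (A.iff B) = (v A == v B) := by
  simp only [Form.iff, h.and, h.imp]
  cases v A <;> cases v B <;> rfl

theorem top : v Form.top = true := by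
  simp [Form.top, h.neg, h.bot]

theorem conj : ∀ l : List Form, v (Form.conj l) = l.all v
  | [] => by simp [Form.conj, h.top]
  | [A] => by simp [Form.conj]
  | A :: B :: l => by
    have := conj (B :: l)
    simp only [Form.conj, h.and, this, List.all_cons]

theorem subst (A : PropForm) (σ : ℕ → Form) : v (A.subst σ) = A.eval (fun n => v (σ n)) := by
  induction A with
  | bot => exact h.bot
  | var n => rfl
  | neg A ih => simp [PropForm.subst, PropForm.eval, h.neg, ih]
  | and A B ihA ihB => simp [PropForm.subst, PropForm.eval, h.and, ihA, ihB]

end IsBoolHom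

instance : Countable Letter := by
  have h : Function.Injective (fun l : Letter => match l with
      | .bot => 0 | .neg => 1 | .and => 2 | .cond => 3 | .var => 4
      | .bit b => if b then 5 else 6 : Letter → ℕ) := by
    rintro (_ | _ | _ | _ | _ | (_ | _)) (_ | _ | _ | _ | _ | (_ | _)) <;> simp
  exact h.countable

instance : Countable Form := Form.code_injective.countable

instance : Inhabited Form := ⟨.bot⟩

/-- The propositional skeleton of a formula, with variables and conditionals as atoms. -/
noncomputable def Form.skeleton (e : Form → ℕ) : Form → PropForm
  | .bot => .bot
  | .var n => .var (e (.var n))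
  | .neg A => .neg (A.skeleton e)
  | .and A B => .and (A.skeleton e) (B.skeleton e)
  | .cond A B => .var (e (.cond A B))

theorem Form.skeleton_subst {e : Form → ℕ} {σ : ℕ → Form} (h : ∀ A, σ (e A) = A) (A : Form) :
    (A.skeleton e).subst σ = A := by
  induction A with
  | bot => rfl
  | var n => exact h _
  | neg A ih => simp [skeleton, PropForm.subst, ih]
  | and A B ihA ihB => simp [skeleton, PropForm.subst, ihA, ihB]
  | cond A B => exact h _

/-- The Boolean extension of a truth assignment to variables and conditionals. -/
def boolExt (a : Form → Bool) : Form → Bool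
  | .bot => false
  | .var n => a (.var n)
  | .neg A => !boolExt a A
  | .and A B => boolExt a A && boolExt a B
  | .cond A B => a (.cond A B)

theorem isBoolHom_boolExt (a : Form → Bool) : IsBoolHom (boolExt a) :=
  ⟨rfl, fun _ => rfl, fun _ _ => rfl⟩

theorem eval_skeleton (e : Form → ℕ) (w : ℕ → Bool) (A : Form) :
    (A.skeleton e).eval w = boolExt (fun B => w (e B)) A := by
  induction A with
  | bot => rfl
  | var n => rfl
  | neg A ih => simp [Form.skeleton, PropForm.eval, boolExt, ih]
  | and A B ihA ihB => simp [Form.skeleton, PropForm.eval, boolExt, ihA, ihB]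
  | cond A B => rfl

variable {R : Set Rule}

/-- Replacing variables and conditionals by distinct propositional variables, along an injection of
the countable set of formulas into `ℕ`, exhibits `A` as an instance of a tautology. -/
theorem HilbertDerivable.of_isBoolHom {A : Form} (h : ∀ v, IsBoolHom v → v A = true) :
    HilbertDerivable R A := by
  obtain ⟨e, he⟩ := exists_injective_nat Form
  have hs : ∀ B, Function.invFun e (e B) = B := Function.leftInverse_invFun he
  rw [← Form.skeleton_subst hs A]
  refine .taut _ _ fun w => ?_
  rw [eval_skeleton]
  exact h _ (isBoolHom_boolExt _)

theorem HilbertDerivable.of_forall_mem : ∀ (l : List Form) {A : Form},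
    (∀ B ∈ l, HilbertDerivable R B) →
    (∀ v, IsBoolHom v → (∀ B ∈ l, v B = true) → v A = true) → HilbertDerivable R A
  | [], _, _, h => .of_isBoolHom fun v hv => h v hv (by simp)
  | B :: l, A, hl, h => by
    refine .mp B A (hl B (by simp)) (of_forall_mem l (fun C hC => hl C (by simp [hC])) ?_)
    intro v hv hvl
    rw [hv.imp]
    cases hB : v B with
    | false => rfl
    | true => simpa using h v hv (by simpa [hB] using hvl)

/-! ### Maximal consistent sets -/

/-- The characteristic functions of the maximal consistent sets. -/
structure IsUltra (R : Set Rule) (v : Form → Bool) : Prop extends IsBoolHom v where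
  derivable : ∀ A, HilbertDerivable R A → v A = true

/-- Lindenbaum's lemma by compactness of `Form → Bool`. The Boolean assignments refuting `A` form a
compact set, and each derivable formula cuts out a closed condition. If no assignment met all of
them, finitely many derivable formulas would already imply `A`. -/
theorem exists_isUltra_of_not_derivable {A : Form} (hA : ¬ HilbertDerivable R A) :
    ∃ v, IsUltra R v ∧ v A = false := by
  by_contra hcon
  let H : Set (Form → Bool) := {v | IsBoolHom v ∧ v A = false}
  have hH : IsCompact H := by
    have hb : ∀ f g : (Form → Bool) → Bool, Continuous f → Continuous g →
        IsClosed {v | f v = g v} := fun f g hf hg => isClosed_eq hf hg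
    have heq : H = {v | v .bot = false} ∩ (⋂ B, {v | v (.neg B) = !v B}) ∩
        (⋂ B, ⋂ C, {v | v (.and B C) = (v B && v C)}) ∩ {v | v A = false} := by
      ext v
      simp only [H, Set.mem_inter_iff, Set.mem_ofPred_eq, Set.mem_iInter]
      exact ⟨fun ⟨h, h'⟩ => ⟨⟨⟨h.bot, h.neg⟩, h.and⟩, h'⟩,
        fun ⟨⟨⟨h1, h2⟩, h3⟩, h'⟩ => ⟨⟨h1, h2, h3⟩, h'⟩⟩
    have hand : Continuous fun p : Bool × Bool => (p.1 && p.2) := continuous_of_discreteTopology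
    have hnot : Continuous fun p : Bool => !p := continuous_of_discreteTopology
    have hap : ∀ B : Form, Continuous fun v : Form → Bool => v B := fun B => continuous_apply B
    rw [heq]
    refine IsClosed.isCompact (((IsClosed.inter ?_ ?_).inter ?_).inter ?_)
    · exact hb _ _ (hap _) continuous_const
    · exact isClosed_iInter fun B => hb _ _ (hap _) (hnot.comp (hap B))
    · exact isClosed_iInter fun B => isClosed_iInter fun C =>
        hb _ _ (hap _) (hand.comp ((hap B).prodMk (hap C)))
    · exact hb _ _ (hap _) continuous_const
  obtain ⟨s, hs⟩ := hH.elim_finite_subfamily_closed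
    (fun B : {B // HilbertDerivable R B} => {v : Form → Bool | v B.1 = true})
    (fun B => isClosed_eq (continuous_apply _) continuous_const) (by
      rw [Set.eq_empty_iff_forall_notMem]
      rintro v ⟨⟨hv, hvA⟩, hv'⟩
      simp only [Set.mem_iInter, Set.mem_ofPred_eq] at hv'
      exact hcon ⟨v, ⟨hv, fun B hB => hv' ⟨B, hB⟩⟩, hvA⟩)
  refine hA (.of_forall_mem (s.toList.map Subtype.val) ?_ ?_)
  · intro B hB
    simp only [List.mem_map] at hB
    obtain ⟨C, -, rfl⟩ := hB
    exact C.2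
  · intro v hv hvl
    by_contra hvA
    have : v ∈ H ∩ ⋂ B ∈ s, {v : Form → Bool | v B.1 = true} := by
      refine ⟨⟨hv, by simpa using hvA⟩, ?_⟩
      simp only [Set.mem_iInter, Set.mem_ofPred_eq]
      exact fun B hB => hvl _ (List.mem_map.2 ⟨B, by simpa using hB, rfl⟩)
    rw [hs] at this
    exact this

/-! ### Conditional logic with `MP` and `CEM` -/

/-- The two logics: `CKIDMPCEM` for `true` and `CKMPCEM` for `false`. -/
def condLogic : Bool → Set Rule
  | true => CKIDMPCEM
  | false => CKMPCEM

variable {d : Bool} {v : Form → Bool}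

theorem RCEA_subset_condLogic : RCEA ⊆ condLogic d := by
  intro r hr
  cases d <;> simp [condLogic, CKIDMPCEM, CKMPCEM, CK, hr]

theorem RCK_subset_condLogic : RCK ⊆ condLogic d := by
  intro r hr
  cases d <;> simp [condLogic, CKIDMPCEM, CKMPCEM, CK, hr]

theorem axMP_subset_condLogic : axMP ⊆ condLogic d := by
  intro r hr
  cases d <;> simp [condLogic, CKIDMPCEM, CKMPCEM, hr]

theorem axCEM_subset_condLogic : axCEM ⊆ condLogic d := by
  intro r hr
  cases d <;> simp [condLogic, CKIDMPCEM, CKMPCEM, hr]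

theorem axID_subset_condLogic (hd : d = true) : axID ⊆ condLogic d := by
  intro r hr
  simp [hd, condLogic, CKIDMPCEM, hr]

theorem condLogic_cases {r : Rule} (hr : r ∈ condLogic d) :
    r ∈ RCEA ∨ r ∈ RCK ∨ (d = true ∧ r ∈ axID) ∨ r ∈ axMP ∨ r ∈ axCEM := by
  cases d <;> simp only [condLogic, CKIDMPCEM, CKMPCEM, CK, Set.mem_union] at hr <;> tauto

namespace IsUltra

variable (h : IsUltra (condLogic d) v)
include h

theorem rck (A B : Form) (Bs : List Form)
    (hB : HilbertDerivable (condLogic d) ((Form.conj Bs).imp B))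
    (hv : ∀ C ∈ Bs, v (A.cond C) = true) : v (A.cond B) = true := by
  have := h.derivable _ (.rule ⟨[(Form.conj Bs).imp B],
    (Form.conj (Bs.map (fun C => A.cond C))).imp (A.cond B)⟩
    (RCK_subset_condLogic ⟨A, B, Bs, rfl⟩) (by simpa using hB))
  rw [h.imp, h.conj] at this
  simp only [List.all_map, Bool.or_eq_true, Bool.not_eq_true'] at this
  rcases this with h1 | h1
  · rw [← Bool.not_eq_true, List.all_eq_true] at h1
    exact absurd (fun C hC => hv C hC) h1
  · exact h1

theorem rck_of_isBoolHom (A B : Form) (Bs : List Form)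
    (hB : ∀ s, IsBoolHom s → (∀ C ∈ Bs, s C = true) → s B = true)
    (hv : ∀ C ∈ Bs, v (A.cond C) = true) : v (A.cond B) = true := by
  refine h.rck A B Bs (.of_isBoolHom fun s hs => ?_) hv
  rw [hs.imp, hs.conj]
  cases hc : Bs.all s with
  | false => rfl
  | true => simpa using hB s hs (by simpa using hc)

theorem cem (A B : Form) : v (A.cond B) = true ∨ v (A.cond B.neg) = true := by
  have := h.derivable _ (.rule ⟨[], (A.cond B).or (A.cond B.neg)⟩
    (axCEM_subset_condLogic ⟨A, B, rfl⟩) (by simp))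
  rw [h.or] at this
  simpa using this

theorem congr_left {A A' : Form} (hA : HilbertDerivable (condLogic d) (A.iff A')) (B : Form) :
    v (A.cond B) = v (A'.cond B) := by
  have := h.derivable _ (.rule ⟨[A.iff A'], (A.cond B).iff (A'.cond B)⟩
    (RCEA_subset_condLogic ⟨A, A', B, rfl⟩) (by simpa using hA))
  rw [h.iff] at this
  simpa using this

/-- MP gives one direction. If `B` is true but `A ⇒ B` is not, CEM yields `A ⇒ ¬B`, and MP then
makes `¬B` true. -/
theorem cond_of_true {A : Form} (hA : v A = true) (B : Form) : v (A.cond B) = v B := by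
  have key : ∀ C, v (A.cond C) = true → v C = true := by
    intro C hC
    have := h.derivable _ (.rule ⟨[], (A.cond C).imp (A.imp C)⟩
      (axMP_subset_condLogic ⟨A, C, rfl⟩) (by simp))
    simpa [h.imp, hC, hA] using this
  cases hB : v B with
  | true =>
    rcases h.cem A B with h1 | h1
    · exact h1
    · simpa [h.neg, hB] using key _ h1
  | false =>
    cases hc : v (A.cond B) with
    | false => rfl
    | true => rw [key B hc] at hB; exact hB

theorem cond_of_cond_bot {A : Form} (hA : v (A.cond .bot) = true) (B : Form) :
    v (A.cond B) = true :=
  h.rck_of_isBoolHom A B [.bot] (fun s hs hb => by simp [hs.bot] at hb) (by simpa using hA)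

/-- CEM makes the set complete and RCK closes it under the Boolean connectives. Consistency is the
hypothesis: `A ⇒ B` and `A ⇒ ¬B` together give `A ⇒ ⊥`. RCK with no premise supplies the theorems.
-/
theorem successor {A : Form} (hA : v (A.cond .bot) = false) :
    IsUltra (condLogic d) fun B => v (A.cond B) where
  bot := hA
  neg B := by
    rcases h1 : v (A.cond B) with _ | _
    · simpa [h1] using h.cem A B
    · by_contra hcon
      have h2 : v (A.cond B.neg) = true := by simpa using hcon
      have := h.rck_of_isBoolHom A .bot [B, B.neg]
        (fun s hs hb => by simp [hs.neg] at hb) (by simp [h1, h2])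
      simp [this] at hA
  and B C := by
    have h1 := h.rck_of_isBoolHom A (B.and C) [B, C] (fun s hs hb => by simpa [hs.and] using hb)
    have h2 := h.rck_of_isBoolHom A B [B.and C]
      (fun s hs hb => by simp [hs.and] at hb; exact hb.1)
    have h3 := h.rck_of_isBoolHom A C [B.and C]
      (fun s hs hb => by simp [hs.and] at hb; exact hb.2)
    simp only [List.forall_mem_cons, List.not_mem_nil, false_imp_iff, implies_true,
      and_true] at h1 h2 h3
    rw [Bool.eq_iff_iff, Bool.and_eq_true]
    exact ⟨fun h' => ⟨h2 h', h3 h'⟩, fun h' => h1 h'⟩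
  derivable B hB := by
    refine h.rck A B [] (.of_forall_mem [B] (by simpa using hB) fun s hs hb => ?_) (by simp)
    rw [hs.imp]
    simpa using Or.inr (hb B (by simp))

end IsUltra

theorem IsUltra.cond_self (hd : d = true) (h : IsUltra (condLogic d) v) (A : Form) :
    v (A.cond A) = true :=
  h.derivable _ (.rule ⟨[], A.cond A⟩ (axID_subset_condLogic hd ⟨A, rfl⟩) (by simp))

/-- Truth at a new world with the variables `p` true, from which the worlds `g A` are selected. -/
def rootVal (p : ℕ → Bool) (g : Form → Option (Form → Bool)) : Form → Bool
  | .bot => false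
  | .var n => p n
  | .neg A => !rootVal p g A
  | .and A B => rootVal p g A && rootVal p g B
  | .cond A B => if rootVal p g A then rootVal p g B else (g A).elim true fun s => s B

theorem isBoolHom_rootVal (p : ℕ → Bool) (g : Form → Option (Form → Bool)) :
    IsBoolHom (rootVal p g) :=
  ⟨rfl, fun _ => rfl, fun _ _ => rfl⟩

/-- Induction on derivations. A true antecedent selects the root itself, which gives MP. Having at
most one successor gives CEM. RCEA needs `hcongr` for false antecedents. RCK uses the induction
hypothesis at the root and derivability of the premise at the successor. -/
theorem isUltra_rootVal (p : ℕ → Bool) (g : Form → Option (Form → Bool))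
    (hg : ∀ A, ∀ s ∈ g A, IsUltra (condLogic d) s)
    (hcongr : ∀ A A', HilbertDerivable (condLogic d) (A.iff A') → g A = g A')
    (hid : d = true → ∀ A, ∀ s ∈ g A, s A = true) :
    IsUltra (condLogic d) (rootVal p g) := by
  have hb := isBoolHom_rootVal p g
  refine ⟨hb, fun D hD => ?_⟩
  induction hD with
  | taut A σ hA => rw [hb.subst]; exact hA _
  | mp A B hA hAB ihA ihAB => simpa [hb.imp, ihA] using ihAB
  | rule r hr hp ih =>
    rcases condLogic_cases hr with ⟨A, A', B, rfl⟩ | ⟨A, B, Bs, rfl⟩ | ⟨hd, A, rfl⟩ |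
      ⟨A, B, rfl⟩ | ⟨A, B, rfl⟩
    · have h1 := ih _ (List.mem_singleton.2 rfl)
      have h2 := hcongr _ _ (hp _ (List.mem_singleton.2 rfl))
      rw [hb.iff] at h1
      simp only [beq_iff_eq] at h1
      rw [hb.iff]
      simp [rootVal, h1, h2]
    · have h1 := ih _ (List.mem_singleton.2 rfl)
      have h2 := hp _ (List.mem_singleton.2 rfl)
      rw [hb.imp, hb.conj] at h1
      rw [hb.imp, hb.conj]
      simp only [List.all_map, Function.comp_def, rootVal]
      cases hA : rootVal p g A with
      | true => simpa using h1
      | false =>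
        cases hgA : g A with
        | none => simp
        | some s =>
          have hs := hg A s (by simp [hgA])
          have h3 := hs.derivable _ h2
          rw [hs.imp, hs.conj] at h3
          simpa using h3
    · rw [rootVal]
      cases hA : rootVal p g A with
      | true => simp
      | false =>
        cases hgA : g A with
        | none => simp
        | some s => simpa using hid hd A s (by simp [hgA])
    · rw [hb.imp, hb.imp, rootVal]
      cases hA : rootVal p g A <;> simp
    · rw [hb.or, rootVal, rootVal]
      cases hA : rootVal p g A with
      | true => simp [hb.neg]
      | false =>
        cases hgA : g A with
        | none => simp
        | some s => simp [(hg A s (by simp [hgA])).neg]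

/-- One world without other successors: this is the consistency of the logic, and the base case for
zero rounds. -/
theorem exists_isUltra_condLogic (d : Bool) : ∃ v, IsUltra (condLogic d) v :=
  ⟨_, isUltra_rootVal (fun _ => false) (fun _ => none) (by simp) (by simp) (by simp)⟩

/-! ### Occurrences of subformulas -/

/-- The subformula occurrences, with their offsets, in a copy of the formula at offset `o`. -/
def Form.occ : Form → ℕ → List (Form × ℕ)
  | .bot, o => [(.bot, o)]
  | .var n, o => [(.var n, o)]
  | .neg A, o => (.neg A, o) :: A.occ (o + 1)
  | .and A B, o => (.and A B, o) :: (A.occ (o + 1) ++ B.occ (o + 1 + A.code.length))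
  | .cond A B, o => (.cond A B, o) :: (A.occ (o + 1) ++ B.occ (o + 1 + A.code.length))

/-- The position that carries the label of the occurrence of a formula at offset `o`. -/
def Form.pos : Form → ℕ → ℕ
  | .var n, o => o + n.bits.length
  | _, o => o

@[simp] theorem Form.pos_bot (o : ℕ) : Form.bot.pos o = o := rfl
@[simp] theorem Form.pos_var (n o : ℕ) : (Form.var n).pos o = o + n.bits.length := rfl
@[simp] theorem Form.pos_neg (A : Form) (o : ℕ) : A.neg.pos o = o := rfl
@[simp] theorem Form.pos_and (A B : Form) (o : ℕ) : (A.and B).pos o = o := rfl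
@[simp] theorem Form.pos_cond (A B : Form) (o : ℕ) : (A.cond B).pos o = o := rfl

theorem Form.self_mem_occ (A : Form) (o : ℕ) : (A, o) ∈ A.occ o := by
  cases A <;> simp [occ]

theorem Form.occ_subset (φ : Form) : ∀ (o : ℕ) (q : Form × ℕ), q ∈ φ.occ o →
    q.1.occ q.2 ⊆ φ.occ o := by
  induction φ with
  | bot => intro o q hq; simp only [occ, List.mem_singleton] at hq; subst hq; simp
  | var n => intro o q hq; simp only [occ, List.mem_singleton] at hq; subst hq; simp
  | neg A ih =>
    intro o q hq
    simp only [occ, List.mem_cons] at hq ⊢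
    rcases hq with rfl | hq
    · simp [occ]
    · exact fun r hr => by simpa using Or.inr (ih _ _ hq hr)
  | and A B ihA ihB =>
    intro o q hq
    simp only [occ, List.mem_cons, List.mem_append] at hq
    rcases hq with rfl | hq | hq
    · simp
    · exact fun r hr => by simpa [occ] using Or.inr (Or.inl (ihA _ _ hq hr))
    · exact fun r hr => by simpa [occ] using Or.inr (Or.inr (ihB _ _ hq hr))
  | cond A B ihA ihB =>
    intro o q hq
    simp only [occ, List.mem_cons, List.mem_append] at hq
    rcases hq with rfl | hq | hq
    · simp
    · exact fun r hr => by simpa [occ] using Or.inr (Or.inl (ihA _ _ hq hr))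
    · exact fun r hr => by simpa [occ] using Or.inr (Or.inr (ihB _ _ hq hr))

theorem Form.mem_occ_of_cond {φ A B : Form} {o p : ℕ} (h : (A.cond B, p) ∈ φ.occ o) :
    (A, p + 1) ∈ φ.occ o ∧ (B, p + 1 + A.code.length) ∈ φ.occ o :=
  ⟨φ.occ_subset o _ h (by simp [occ, self_mem_occ]),
    φ.occ_subset o _ h (by simp [occ, self_mem_occ])⟩

theorem Form.pos_mem_occ (φ : Form) : ∀ (o : ℕ) (q : Form × ℕ), q ∈ φ.occ o →
    o ≤ q.1.pos q.2 ∧ q.1.pos q.2 < o + φ.code.length := by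
  induction φ with
  | bot => intro o q hq; simp only [occ, List.mem_singleton] at hq; subst hq; simp [pos, code]
  | var n => intro o q hq; simp only [occ, List.mem_singleton] at hq; subst hq; simp [pos, code]
  | neg A ih =>
    intro o q hq
    simp only [occ, List.mem_cons] at hq
    simp only [code, List.length_cons]
    rcases hq with rfl | hq
    · simp [pos]
    · have := ih _ _ hq; omega
  | and A B ihA ihB =>
    intro o q hq
    simp only [occ, List.mem_cons, List.mem_append] at hq
    simp only [code, List.length_cons, List.length_append]
    rcases hq with rfl | hq | hq
    · simp [pos]
    · have := ihA _ _ hq; omega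
    · have := ihB _ _ hq; omega
  | cond A B ihA ihB =>
    intro o q hq
    simp only [occ, List.mem_cons, List.mem_append] at hq
    simp only [code, List.length_cons, List.length_append]
    rcases hq with rfl | hq | hq
    · simp [pos]
    · have := ihA _ _ hq; omega
    · have := ihB _ _ hq; omega

theorem Form.pairwise_occ (φ : Form) : ∀ o : ℕ,
    (φ.occ o).Pairwise fun q r => q.1.pos q.2 < r.1.pos r.2 := by
  induction φ with
  | bot => intro o; simp [occ]
  | var n => intro o; simp [occ]
  | neg A ih =>
    intro o
    simp only [occ, List.pairwise_cons]
    refine ⟨fun r hr => ?_, ih _⟩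
    have := A.pos_mem_occ _ _ hr
    simp only [pos_neg, pos_and, pos_cond]; omega
  | and A B ihA ihB =>
    intro o
    simp only [occ, List.pairwise_cons, List.pairwise_append, List.mem_append]
    refine ⟨?_, ihA _, ihB _, fun q hq r hr => ?_⟩
    · rintro r (hr | hr)
      · have := A.pos_mem_occ _ _ hr
        simp only [pos_neg, pos_and, pos_cond]; omega
      · have := B.pos_mem_occ _ _ hr
        simp only [pos_neg, pos_and, pos_cond]; omega
    · have h1 := A.pos_mem_occ _ _ hq
      have h2 := B.pos_mem_occ _ _ hr
      omega
  | cond A B ihA ihB =>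
    intro o
    simp only [occ, List.pairwise_cons, List.pairwise_append, List.mem_append]
    refine ⟨?_, ihA _, ihB _, fun q hq r hr => ?_⟩
    · rintro r (hr | hr)
      · have := A.pos_mem_occ _ _ hr
        simp only [pos_neg, pos_and, pos_cond]; omega
      · have := B.pos_mem_occ _ _ hr
        simp only [pos_neg, pos_and, pos_cond]; omega
    · have h1 := A.pos_mem_occ _ _ hq
      have h2 := B.pos_mem_occ _ _ hr
      omega

/-- Label positions increase strictly along `occ`, so a letter of the word can carry the label of
its occurrence without ambiguity. -/
theorem Form.occ_unique {φ : Form} {o : ℕ} {q r : Form × ℕ} (hq : q ∈ φ.occ o) (hr : r ∈ φ.occ o)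
    (h : q.1.pos q.2 = r.1.pos r.2) : q = r := by
  by_contra hne
  have hp : (φ.occ o).Pairwise fun q r => q.1.pos q.2 ≠ r.1.pos r.2 :=
    (φ.pairwise_occ o).imp fun hab => hab.ne
  have : Std.Symm fun q r : Form × ℕ => q.1.pos q.2 ≠ r.1.pos r.2 := ⟨fun _ _ hab => hab.symm⟩
  exact hp.forall hq hr hne h

theorem Form.exists_code_eq_of_mem_occ (φ : Form) : ∀ (o : ℕ) (q : Form × ℕ), q ∈ φ.occ o →
    ∃ l r, φ.code = l ++ q.1.code ++ r ∧ q.2 = o + l.length := by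
  induction φ with
  | bot =>
    intro o q hq; simp only [occ, List.mem_singleton] at hq; subst hq; exact ⟨[], [], by simp⟩
  | var n =>
    intro o q hq; simp only [occ, List.mem_singleton] at hq; subst hq; exact ⟨[], [], by simp⟩
  | neg A ih =>
    intro o q hq
    simp only [occ, List.mem_cons] at hq
    rcases hq with rfl | hq
    · exact ⟨[], [], by simp⟩
    · obtain ⟨l, r, h, h'⟩ := ih _ _ hq
      exact ⟨.neg :: l, r, by simp [code, h], by simp [h']; omega⟩
  | and A B ihA ihB =>
    intro o q hq
    simp only [occ, List.mem_cons, List.mem_append] at hq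
    rcases hq with rfl | hq | hq
    · exact ⟨[], [], by simp⟩
    · obtain ⟨l, r, h, h'⟩ := ihA _ _ hq
      exact ⟨.and :: l, r ++ B.code, by simp [code, h], by simp [h']; omega⟩
    · obtain ⟨l, r, h, h'⟩ := ihB _ _ hq
      exact ⟨.and :: (A.code ++ l), r, by simp [code, h], by simp [h']; omega⟩
  | cond A B ihA ihB =>
    intro o q hq
    simp only [occ, List.mem_cons, List.mem_append] at hq
    rcases hq with rfl | hq | hq
    · exact ⟨[], [], by simp⟩
    · obtain ⟨l, r, h, h'⟩ := ihA _ _ hq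
      exact ⟨.cond :: l, r ++ B.code, by simp [code, h], by simp [h']; omega⟩
    · obtain ⟨l, r, h, h'⟩ := ihB _ _ hq
      exact ⟨.cond :: (A.code ++ l), r, by simp [code, h], by simp [h']; omega⟩

/-- The nesting depth of conditionals. -/
def Form.depth : Form → ℕ
  | .bot => 0
  | .var _ => 0
  | .neg A => A.depth
  | .and A B => max A.depth B.depth
  | .cond A B => max A.depth B.depth + 1

/-- This is why the length of the word suffices as the number of rounds. -/
theorem Form.depth_lt_length_code (A : Form) : A.depth < A.code.length := by
  induction A <;> simp_all [depth, code] <;> omega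

/-! ### One round of the game -/

/-- The labels of a round: the current type `t`, the challenge `x`, the antecedents `y` claimed to
be equivalent to the challenged one, the second challenge `z`, and the next type `u`. -/
structure Round where
  t : ℕ → Bool
  x : ℕ → Bool
  y : ℕ → Bool
  z : ℕ → Bool
  u : ℕ → Bool

namespace Round

/-- Local coherence of the current type at an occurrence. -/
def coherentAt (ρ : Round) : Form × ℕ → Bool
  | (.bot, o) => !ρ.t o
  | (.var _, _) => true
  | (.neg A, o) => ρ.t o == !ρ.t (A.pos (o + 1))
  | (.and A B, o) => ρ.t o == (ρ.t (A.pos (o + 1)) && ρ.t (B.pos (o + 1 + A.code.length)))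
  | (.cond A B, o) =>
    !ρ.t (A.pos (o + 1)) || (ρ.t o == ρ.t (B.pos (o + 1 + A.code.length)))

/-- At a conditional of the claimed class, the next type decides the consequent as required. -/
def successorAt (ρ : Round) : Form × ℕ → Bool
  | (.cond A B, o) => !ρ.y o || (ρ.u (B.pos (o + 1 + A.code.length)) == ρ.t o)
  | _ => true

/-- At a conditional of the claimed class, the current type is true. -/
def vacuousAt (ρ : Round) : Form × ℕ → Bool
  | (.cond _ _, o) => !ρ.y o || ρ.t o
  | _ => true

/-- The next type at a formula marked by the first challenge. -/
def markedAt (ρ : Round) (q : Form × ℕ) : Option Bool :=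
  bif ρ.x (q.1.pos q.2) then some (ρ.u (q.1.pos q.2)) else none

/-- The next type at the antecedent of a conditional outside the claimed class that is marked
by the second challenge. -/
def refutedAt (ρ : Round) : Form × ℕ → Option Bool
  | (.cond A _, o) => if ρ.z o && !ρ.y o then some (ρ.u (A.pos (o + 1))) else none
  | _ => none

/-- The value claimed for the variable named by the first challenge. -/
def claimAt (ρ : Round) : Form × ℕ → Option Bool
  | (.var n, o) => some (ρ.y (o + n.bits.length))
  | _ => none

/-- The name and the value of a variable marked by the second challenge. -/
def variableAt (ρ : Round) : Form × ℕ → Option (ℕ × Bool)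
  | (.var n, o) => if ρ.z (o + n.bits.length) then some (n, ρ.t (o + n.bits.length)) else none
  | _ => none

/-- The digits marked by the first challenge. -/
def digits (ρ : Round) (w : List Letter) (o : ℕ) : List Bool :=
  (w.zipIdx o).filterMap fun
    | (.bit b, i) => if ρ.x i then some b else none
    | _ => none

/-- The condition on the conditionals. -/
def condOK (ρ : Round) (d : Bool) (l : List (Form × ℕ)) : Bool :=
  match l.findSome? ρ.markedAt, l.findSome? ρ.refutedAt with
  | none, _ => true
  | some a, some b => a != b
  | some a, none => (l.all ρ.successorAt && (!d || a)) || l.all ρ.vacuousAt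

/-- The condition on the variables. -/
def varOK (ρ : Round) (φ : Form) : Bool :=
  match (φ.occ 0).reverse.findSome? ρ.variableAt with
  | none => true
  | some (n, b) => decide (ρ.digits φ.code 0 ≠ n.bits) || some b == (φ.occ 0).findSome? ρ.claimAt

/-- The condition for a round to be won by the player defending satisfiability. -/
def OK (ρ : Round) (d : Bool) (φ : Form) : Bool :=
  (φ.occ 0).all ρ.coherentAt && ρ.condOK d (φ.occ 0) && ρ.varOK φ

end Round

/-- The labels agree with the truth assignment `v`. -/
def Represents (φ : Form) (v : Form → Bool) (t : ℕ → Bool) : Prop :=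
  ∀ q ∈ φ.occ 0, t (q.1.pos q.2) = v q.1

theorem exists_represents (φ : Form) (v : Form → Bool) : ∃ t, Represents φ v t := by
  classical
  refine ⟨fun i => decide (∃ q ∈ φ.occ 0, q.1.pos q.2 = i ∧ v q.1 = true), fun q hq => ?_⟩
  cases hv : v q.1 with
  | true => simpa using ⟨q.1, q.2, hq, rfl, hv⟩
  | false =>
    simp only [decide_eq_false_iff_not]
    rintro ⟨r, hr, hrq, hrv⟩
    rw [Form.occ_unique hr hq hrq, hv] at hrv
    exact Bool.false_ne_true hrv

theorem Represents.coherentAt {φ : Form} {d : Bool} {v : Form → Bool} {ρ : Round}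
    (hv : IsUltra (condLogic d) v) (ht : Represents φ v ρ.t) :
    ∀ q ∈ φ.occ 0, ρ.coherentAt q = true := by
  rintro ⟨ψ, o⟩ hq
  have hs := φ.occ_subset 0 _ hq
  have h0 := ht _ hq
  cases ψ with
  | bot => simpa [Round.coherentAt, hv.bot, Form.pos] using h0
  | var n => rfl
  | neg A =>
    have h1 := ht (A, o + 1) (hs (by simp [Form.occ, Form.self_mem_occ]))
    simp only [Form.pos_neg] at h0 h1
    simp [Round.coherentAt, h0, h1, hv.neg]
  | and A B =>
    have h1 := ht (A, o + 1) (hs (by simp [Form.occ, Form.self_mem_occ]))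
    have h2 := ht (B, o + 1 + A.code.length) (hs (by simp [Form.occ, Form.self_mem_occ]))
    simp only [Form.pos_and] at h0 h1 h2
    simp [Round.coherentAt, h0, h1, h2, hv.and]
  | cond A B =>
    have h1 := ht (A, o + 1) (hs (by simp [Form.occ, Form.self_mem_occ]))
    have h2 := ht (B, o + 1 + A.code.length) (hs (by simp [Form.occ, Form.self_mem_occ]))
    simp only [Form.pos_cond] at h0 h1 h2
    simp only [Round.coherentAt, h0, h1, h2]
    cases hA : v A with
    | false => rfl
    | true => simp [hv.cond_of_true hA]

/-! ### A maximal consistent set survives a round -/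

section Sound

variable {φ : Form} {d : Bool} {v : Form → Bool} {t x : ℕ → Bool}

/-- The defender answers truthfully: `y` is the exact class of provably equivalent antecedents and
the true value of the named variable. A disputed omission is then a non-theorem, refuted in some
maximal consistent set. Without a dispute the canonical successor serves, if it exists. -/
theorem round_sound (hv : IsUltra (condLogic d) v) (ht : Represents φ v t) (x : ℕ → Bool) :
    ∃ y, ∀ z, ∃ u v', IsUltra (condLogic d) v' ∧ Represents φ v' u ∧
      Round.OK ⟨t, x, y, z, u⟩ d φ = true := by
  classical
  -- Only the component `x` matters for the digits; the other entries are fillers.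
  let D := Round.digits ⟨t, x, x, x, x⟩ φ.code 0
  let b : Bool := decide (∃ n : ℕ, D = n.bits ∧ v (.var n) = true)
  let E : Form → Prop := fun A' =>
    ∃ q, (φ.occ 0).find? (fun q => x (q.1.pos q.2)) = some q ∧
      HilbertDerivable (condLogic d) (A'.iff q.1)
  -- One labelling carries both claims: class membership at positions of conditionals, the value `b`
  -- everywhere else and so at all variables.
  let y : ℕ → Bool := fun i =>
    if ∃ A B, (Form.cond A B, i) ∈ φ.occ 0 then
      decide (∃ A B, (Form.cond A B, i) ∈ φ.occ 0 ∧ E A) else b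
  have hy : ∀ A B i, (Form.cond A B, i) ∈ φ.occ 0 → (y i = true ↔ E A) := by
    intro A B i hi
    have h0 : ∃ A B, (Form.cond A B, i) ∈ φ.occ 0 := ⟨A, B, hi⟩
    simp only [y, if_pos h0, decide_eq_true_eq]
    refine ⟨?_, fun h => ⟨A, B, hi, h⟩⟩
    rintro ⟨A', B', hi', h⟩
    have := Form.occ_unique hi hi' rfl
    simp only [Prod.mk.injEq, Form.cond.injEq, and_true] at this
    rwa [this.1]
  have hyv : ∀ n i, (Form.var n, i) ∈ φ.occ 0 → y (i + n.bits.length) = b := by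
    intro n i hi
    refine if_neg ?_
    rintro ⟨A, B, hAB⟩
    have := Form.occ_unique hi hAB rfl
    simp at this
  refine ⟨y, fun z => ?_⟩
  have hvar : ∀ u, Round.varOK ⟨t, x, y, z, u⟩ φ = true := by
    intro u
    rw [Round.varOK]
    split
    · rfl
    · rename_i n c hf
      obtain ⟨q, hq, hq'⟩ := List.exists_of_findSome?_eq_some hf
      rw [List.mem_reverse] at hq
      obtain ⟨ψ, o⟩ := q
      cases ψ with
      | var m =>
        simp only [Round.variableAt] at hq'
        split_ifs at hq'
        simp only [Option.some.injEq, Prod.mk.injEq] at hq'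
        obtain ⟨rfl, rfl⟩ := hq'
        by_cases hD : D = m.bits
        · have hc : (φ.occ 0).findSome? (Round.claimAt ⟨t, x, y, z, u⟩) = some b := by
            cases hc : (φ.occ 0).findSome? (Round.claimAt ⟨t, x, y, z, u⟩) with
            | none =>
              rw [List.findSome?_eq_none_iff] at hc
              simpa [Round.claimAt] using hc _ hq
            | some c =>
              obtain ⟨⟨ψ, i⟩, hr, hr'⟩ := List.exists_of_findSome?_eq_some hc
              cases ψ with
              | var k =>
                simp only [Round.claimAt, Option.some.injEq] at hr'
                rw [← hr', hyv _ _ hr]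
              | _ => simp [Round.claimAt] at hr'
          rw [hc]
          have h1 := ht _ hq
          simp only [Form.pos_var] at h1
          have h2 : b = v (.var m) := by
            cases hm : v (.var m) with
            | true => simpa [b] using ⟨m, hD, hm⟩
            | false =>
              simp only [b, decide_eq_false_iff_not]
              rintro ⟨k, hk, hk'⟩
              have : Form.code (.var m) = Form.code (.var k) := by
                simp [Form.code, ← hk, hD]
              rw [← Form.code_injective this, hm] at hk'
              exact Bool.false_ne_true hk'
          simp [h1, h2]
        · have : Round.digits ⟨t, x, y, z, u⟩ φ.code 0 ≠ m.bits := hD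
          simp [this]
      | _ => simp [Round.variableAt] at hq'
  suffices h : ∃ u v', IsUltra (condLogic d) v' ∧ Represents φ v' u ∧
      Round.condOK ⟨t, x, y, z, u⟩ d (φ.occ 0) = true by
    obtain ⟨u, v', h1, h2, h3⟩ := h
    refine ⟨u, v', h1, h2, ?_⟩
    simp only [Round.OK, hvar, h3, Bool.and_true, List.all_eq_true]
    exact Represents.coherentAt (ρ := ⟨t, x, y, z, u⟩) hv ht
  have hmark : ∀ u, (φ.occ 0).findSome? (Round.markedAt ⟨t, x, y, z, u⟩) =
      ((φ.occ 0).find? (fun q => x (q.1.pos q.2))).map fun q => u (q.1.pos q.2) := by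
    intro u
    generalize φ.occ 0 = l
    induction l with
    | nil => rfl
    | cons q l ih =>
      simp only [List.findSome?_cons, List.find?_cons, Round.markedAt]
      cases x (q.1.pos q.2) with
      | true => rfl
      | false => simpa [Round.markedAt] using ih
  cases hx : (φ.occ 0).find? (fun q => x (q.1.pos q.2)) with
  | none =>
    obtain ⟨u, hu⟩ := exists_represents φ v
    exact ⟨u, v, hv, hu, by simp [Round.condOK, hmark, hx]⟩
  | some a =>
    have ha := List.mem_of_find?_eq_some hx
    have hE : ∀ A, E A ↔ HilbertDerivable (condLogic d) (A.iff a.1) := by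
      intro A; simp [E, hx]
    -- Is some omission disputed? If several are, only the first one counts.
    by_cases hz : ∃ A B i, (Form.cond A B, i) ∈ φ.occ 0 ∧ z i = true ∧ y i = false
    · have href' : ∃ A i, (A, i + 1) ∈ φ.occ 0 ∧ ¬ E A ∧ ∀ u,
          (φ.occ 0).findSome? (Round.refutedAt ⟨t, x, y, z, u⟩) = some (u (A.pos (i + 1))) := by
        cases hf : (φ.occ 0).find? (fun q => match q with
          | (.cond _ _, i) => z i && !y i
          | _ => false) with
        | none =>
          obtain ⟨A, B, i, hi, hzi, hyi⟩ := hz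
          rw [List.find?_eq_none] at hf
          simpa [hzi, hyi] using hf _ hi
        | some q =>
          have hq := List.mem_of_find?_eq_some hf
          have hq' := List.find?_some hf
          obtain ⟨ψ, i⟩ := q
          cases ψ with
          | cond A B =>
            simp only [Bool.and_eq_true, Bool.not_eq_true'] at hq'
            refine ⟨A, i, (Form.mem_occ_of_cond hq).1, ?_, fun u => ?_⟩
            · rw [← hy A B i hq, hq'.2]; simp
            · clear * - hf
              generalize φ.occ 0 = l at hf ⊢
              induction l with
              | nil => simp at hf
              | cons q l ih =>
                obtain ⟨ψ, j⟩ := q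
                simp only [List.findSome?_cons, List.find?_cons] at hf ⊢
                cases ψ with
                | cond A' B' =>
                  cases hc : (z j && !y j) with
                  | true =>
                    simp only [hc, Option.some.injEq, Prod.mk.injEq, Form.cond.injEq] at hf
                    obtain ⟨⟨rfl, rfl⟩, rfl⟩ := hf
                    simp only [Round.refutedAt, hc, if_true]
                  | false => simpa [Round.refutedAt, hc] using ih (by simpa [hc] using hf)
                | _ => simpa [Round.refutedAt] using ih (by simpa using hf)
          | _ => simp at hq'
      obtain ⟨A, i, hi, hEA, hu⟩ := href'
      rw [hE] at hEA
      obtain ⟨v', hv', hne⟩ := exists_isUltra_of_not_derivable hEA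
      obtain ⟨u, hr⟩ := exists_represents φ v'
      refine ⟨u, v', hv', hr, ?_⟩
      rw [hv'.iff] at hne
      have h1 := hr _ hi
      have h2 := hr _ ha
      simp only at h1
      simp only [Round.condOK, hmark, hx, hu, Option.map_some, h1, h2]
      simp only [beq_eq_false_iff_ne, ne_eq] at hne
      simpa using fun h => hne h.symm
    · have href : ∀ u, (φ.occ 0).findSome? (Round.refutedAt ⟨t, x, y, z, u⟩) = none := by
        intro u
        rw [List.findSome?_eq_none_iff]
        rintro ⟨ψ, i⟩ hi
        cases ψ with
        | cond A B =>
          simp only [Round.refutedAt]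
          refine if_neg fun h => hz ⟨A, B, i, hi, ?_⟩
          simpa using h
        | _ => rfl
      have hyE : ∀ A B i, (Form.cond A B, i) ∈ φ.occ 0 → y i = true →
          t i = v (a.1.cond B) := by
        intro A B i hi hyi
        rw [hy A B i hi, hE] at hyi
        have h1 := ht _ hi
        simp only [Form.pos_cond] at h1
        rw [h1, hv.congr_left hyi]
      -- If `a ⇒ ⊥` is true there is no successor and all claimed conditionals hold; `u` is then
      -- unconstrained by the round, and `v` itself supplies it.
      cases hb : v (a.1.cond .bot) with
      | true =>
        obtain ⟨u, hr⟩ := exists_represents φ v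
        refine ⟨u, v, hv, hr, ?_⟩
        simp only [Round.condOK, hmark, hx, href, Option.map_some, Bool.or_eq_true]
        right
        rw [List.all_eq_true]
        rintro ⟨ψ, i⟩ hi
        cases ψ with
        | cond A B =>
          simp only [Round.vacuousAt]
          cases hyi : y i with
          | false => rfl
          | true => simp [hyE A B i hi hyi, hv.cond_of_cond_bot hb]
        | _ => rfl
      | false =>
        obtain ⟨u, hr⟩ := exists_represents φ fun B => v (a.1.cond B)
        refine ⟨u, _, hv.successor hb, hr, ?_⟩
        simp only [Round.condOK, hmark, hx, href, Option.map_some, Bool.or_eq_true,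
          Bool.and_eq_true]
        left
        refine ⟨?_, ?_⟩
        · rw [List.all_eq_true]
          rintro ⟨ψ, i⟩ hi
          cases ψ with
          | cond A B =>
            simp only [Round.successorAt]
            cases hyi : y i with
            | false => rfl
            | true =>
              have h1 := hr _ (Form.mem_occ_of_cond hi).2
              simp only at h1
              simp [h1, hyE A B i hi hyi]
          | _ => rfl
        · rw [hr _ ha]
          cases d with
          | false => exact Or.inl rfl
          | true => exact Or.inr (hv.cond_self rfl _)

end Sound

/-- Some maximal consistent set agrees with the labels on the formulas of depth less than `k`. -/
def AgreesBelow (d : Bool) (φ : Form) (k : ℕ) (t : ℕ → Bool) : Prop :=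
  ∃ v, IsUltra (condLogic d) v ∧ ∀ q ∈ φ.occ 0, q.1.depth < k → t (q.1.pos q.2) = v q.1

theorem Form.digits_of_mem_occ {φ : Form} {n o : ℕ} (h : (Form.var n, o) ∈ φ.occ 0) (ρ : Round)
    (hx : ∀ i, ρ.x i = decide (o ≤ i ∧ i < o + n.bits.length)) :
    ρ.digits φ.code 0 = n.bits := by
  obtain ⟨l, r, hc, ho⟩ := φ.exists_code_eq_of_mem_occ 0 _ h
  simp only [zero_add] at ho
  subst ho
  have hout : ∀ (m : List Letter) (k : ℕ), (k + m.length ≤ l.length ∨ l.length + n.bits.length ≤ k) →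
      ρ.digits m k = [] := by
    intro m
    induction m with
    | nil => intro k _; rfl
    | cons a m ih =>
      intro k hk
      have hxk : ρ.x k = false := by
        rw [hx, decide_eq_false_iff_not]
        simp only [List.length_cons] at hk
        omega
      have := ih (k + 1) (by simp only [List.length_cons] at hk; omega)
      simp only [Round.digits] at this ⊢
      cases a <;> simp [List.zipIdx_cons, this, hxk]
  have hin : ∀ (m : List Bool) (k : ℕ), l.length ≤ k → k + m.length ≤ l.length + n.bits.length →
      ρ.digits (m.map Letter.bit) k = m := by
    intro m
    induction m with
    | nil => intro k _ _; rfl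
    | cons a m ih =>
      intro k hk hk'
      simp only [List.length_cons] at hk'
      have hxk : ρ.x k = true := by
        rw [hx, decide_eq_true_iff]
        omega
      have := ih (k + 1) (by omega) (by omega)
      simp only [Round.digits] at this ⊢
      simp [List.zipIdx_cons, this, hxk]
  have happ : ∀ (m m' : List Letter) k, ρ.digits (m ++ m') k =
      ρ.digits m k ++ ρ.digits m' (k + m.length) := by
    intro m m' k
    simp [Round.digits, List.zipIdx_append]
  rw [hc, Form.code, happ, happ, happ, hout l 0 (by simp), hout r _ (by simp),
    hin _ _ (by simp) (by simp), hout [Letter.var] _ (by simp)]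
  simp

theorem List.findSome?_of_unique {α β : Type*} {f : α → Option β} {l : List α} {a : α} {b : β}
    (ha : a ∈ l) (hb : f a = some b) (h : ∀ c ∈ l, ∀ b', f c = some b' → b' = b) :
    l.findSome? f = some b := by
  cases hf : l.findSome? f with
  | none =>
    rw [List.findSome?_eq_none_iff] at hf
    rw [hf a ha] at hb
    exact absurd hb (by simp)
  | some b' =>
    obtain ⟨c, hc, hc'⟩ := List.exists_of_findSome?_eq_some hf
    rw [h c hc b' hc']

/-- The winning answers provide a successor for every antecedent of depth less than `k`. `rootVal`
glues these under a new root, and local coherence of `t` carries the agreement up the subformulas. A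
conditional exceeds its antecedent and consequent in depth, so one level is gained per round. -/
theorem round_complete {d : Bool} {φ : Form} {k : ℕ} {t : ℕ → Bool}
    (h : ∀ x, ∃ y, ∀ z, ∃ u, Round.OK ⟨t, x, y, z, u⟩ d φ = true ∧ AgreesBelow d φ k u) :
    AgreesBelow d φ (k + 1) t := by
  classical
  have hcoh : ∀ q ∈ φ.occ 0, Round.coherentAt ⟨t, t, t, t, t⟩ q = true := by
    intro q hq
    -- Coherence concerns `t` alone, so arbitrary challenges reveal it.
    obtain ⟨y, hy⟩ := h t
    obtain ⟨u, hu, -⟩ := hy t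
    simp only [Round.OK, Bool.and_eq_true, List.all_eq_true] at hu
    have := hu.1.1 q hq
    obtain ⟨ψ, o⟩ := q
    cases ψ <;> exact this
  have hvar : ∀ n, ∃ b, ∀ o, (Form.var n, o) ∈ φ.occ 0 → t (o + n.bits.length) = b := by
    intro n
    by_cases hn : ∃ o, (Form.var n, o) ∈ φ.occ 0
    · obtain ⟨o, ho⟩ := hn
      -- The challenge spells the name of `n` as written at `o`. The defender commits to a value
      -- before knowing which occurrence `o'` will be selected, so all occurrences share it.
      obtain ⟨y, hy⟩ := h fun i => decide (o ≤ i ∧ i < o + n.bits.length)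
      have key : ∀ o', (Form.var n, o') ∈ φ.occ 0 → some (t (o' + n.bits.length)) =
          (φ.occ 0).findSome? (Round.claimAt ⟨t, t, y, t, t⟩) := by
        intro o' ho'
        obtain ⟨u, hu, -⟩ := hy fun i => decide (i = o' + n.bits.length)
        simp only [Round.OK, Bool.and_eq_true] at hu
        have h2 := hu.2
        rw [Round.varOK, List.findSome?_of_unique (a := (Form.var n, o'))
          (b := (n, t (o' + n.bits.length))) (by simpa using ho')
          (by simp [Round.variableAt])] at h2
        · have hD : Round.digits ⟨t, fun i => decide (o ≤ i ∧ i < o + n.bits.length), y,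
              fun i => decide (i = o' + n.bits.length), u⟩ φ.code 0 = n.bits :=
            Form.digits_of_mem_occ ho _ fun _ => rfl
          simp only [hD, ne_eq, not_true_eq_false,
            decide_false, Bool.false_or, beq_iff_eq] at h2
          rw [h2]
          congr 1
        · rintro ⟨ψ, i⟩ hq b' hb'
          cases ψ with
          | var m =>
            simp only [Round.variableAt] at hb'
            split_ifs at hb' with hm
            simp only [decide_eq_true_eq] at hm
            have := Form.occ_unique (List.mem_reverse.1 hq) ho' hm
            simp only [Prod.mk.injEq, Form.var.injEq] at this
            obtain ⟨rfl, rfl⟩ := this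
            simpa using hb'.symm
          | _ => simp [Round.variableAt] at hb'
      refine ⟨t (o + n.bits.length), fun o' ho' => ?_⟩
      exact Option.some_injective _ ((key o' ho').trans (key o ho).symm)
    · exact ⟨true, fun o ho => absurd ⟨o, ho⟩ hn⟩
  choose p hp using hvar
  have hsucc : ∀ q ∈ φ.occ 0, q.1.depth < k → ∃ W : Option (Form → Bool),
      (∀ s ∈ W, IsUltra (condLogic d) s ∧ (d = true → s q.1 = true)) ∧
      ∀ A B o, (Form.cond A B, o) ∈ φ.occ 0 → (Form.cond A B).depth < k + 1 →
        HilbertDerivable (condLogic d) (A.iff q.1) → t o = W.elim true fun s => s B := by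
    intro q hq hqk
    obtain ⟨y, hy⟩ := h fun i => decide (i = q.1.pos q.2)
    have hmark : ∀ z u, (φ.occ 0).findSome?
        (Round.markedAt ⟨t, fun i => decide (i = q.1.pos q.2), y, z, u⟩) =
          some (u (q.1.pos q.2)) := by
      intro z u
      refine List.findSome?_of_unique hq (by simp [Round.markedAt]) fun r hr b hb => ?_
      simp only [Round.markedAt, Bool.cond_eq_ite] at hb
      split_ifs at hb with hrq
      simp only [decide_eq_true_eq] at hrq
      simpa [hrq] using hb.symm
    have hyc : ∀ A B o, (Form.cond A B, o) ∈ φ.occ 0 → (Form.cond A B).depth < k + 1 →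
        HilbertDerivable (condLogic d) (A.iff q.1) → y o = true := by
      intro A B o ho hk hA
      by_contra hyo
      simp only [Bool.not_eq_true] at hyo
      -- Dispute the omission at `o`: `u` would have to separate `A` from `q.1`, but it agrees on
      -- both with the maximal consistent set `s`, where they are equivalent.
      obtain ⟨u, hu, s, hs, hus⟩ := hy fun i => decide (i = o)
      have href : (φ.occ 0).findSome? (Round.refutedAt ⟨t, fun i => decide (i = q.1.pos q.2), y,
          fun i => decide (i = o), u⟩) = some (u (A.pos (o + 1))) := by
        refine List.findSome?_of_unique ho (by simp [Round.refutedAt, hyo]) ?_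
        rintro ⟨ψ, i⟩ hr b hb
        cases ψ with
        | cond A' B' =>
          simp only [Round.refutedAt] at hb
          split_ifs at hb with hi
          simp only [Bool.and_eq_true, decide_eq_true_eq] at hi
          have := Form.occ_unique hr ho hi.1
          simp only [Prod.mk.injEq, Form.cond.injEq] at this
          obtain ⟨⟨rfl, rfl⟩, rfl⟩ := this
          simpa using hb.symm
        | _ => simp [Round.refutedAt] at hb
      simp only [Round.OK, Bool.and_eq_true] at hu
      have h2 := hu.1.2
      rw [Round.condOK, hmark, href] at h2
      have h3 := hs.derivable _ hA
      simp only [Form.depth] at hk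
      rw [hs.iff, ← hus _ (Form.mem_occ_of_cond ho).1 (by simp only; omega), ← hus _ hq hqk,
        beq_iff_eq] at h3
      simp [h3] at h2
    -- No dispute: the answer must now be a successor, or the claimed conditionals are all true.
    obtain ⟨u, hu, s, hs, hus⟩ := hy fun _ => false
    have href : (φ.occ 0).findSome? (Round.refutedAt ⟨t, fun i => decide (i = q.1.pos q.2), y,
        fun _ => false, u⟩) = none := by
      rw [List.findSome?_eq_none_iff]
      rintro ⟨ψ, i⟩ hi
      cases ψ <;> simp [Round.refutedAt]
    simp only [Round.OK, Bool.and_eq_true] at hu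
    have h2 := hu.1.2
    rw [Round.condOK, hmark, href] at h2
    simp only [Bool.or_eq_true, Bool.and_eq_true, List.all_eq_true] at h2
    rcases h2 with ⟨h2, h3⟩ | h2
    · refine ⟨some s, ?_, fun A B o ho hk hA => ?_⟩
      · intro s' hs'
        simp only [Option.mem_def, Option.some.injEq] at hs'
        subst hs'
        refine ⟨hs, fun hd => ?_⟩
        rw [← hus q hq hqk]
        simpa [hd] using h3
      · have h4 := h2 _ ho
        simp only [Round.successorAt, hyc A B o ho hk hA, Bool.not_true, Bool.false_or,
          beq_iff_eq] at h4
        simp only [Form.depth] at hk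
        rw [← h4, hus _ (Form.mem_occ_of_cond ho).2 (by simp only; omega)]
        rfl
    · refine ⟨none, by simp, fun A B o ho hk hA => ?_⟩
      simpa [Round.vacuousAt, hyc A B o ho hk hA] using h2 _ ho
  choose! W hW hWc using hsucc
  let P : Form → Form × ℕ → Prop := fun C q =>
    q ∈ φ.occ 0 ∧ q.1.depth < k ∧ HilbertDerivable (condLogic d) (C.iff q.1)
  -- The choice depends only on the predicate `P C`, which is the same for provably equivalent `C`.
  -- This is the congruence required by `isUltra_rootVal`.
  let G : (Form × ℕ → Prop) → Option (Form → Bool) := fun Q =>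
    if hQ : ∃ q, Q q then W hQ.choose else none
  have iff_trans : ∀ {A B C : Form}, HilbertDerivable (condLogic d) (A.iff B) →
      HilbertDerivable (condLogic d) (B.iff C) → HilbertDerivable (condLogic d) (A.iff C) := by
    intro A B C h1 h2
    refine .of_forall_mem [A.iff B, B.iff C] (by simp [h1, h2]) fun v hv hvl => ?_
    simp only [List.forall_mem_cons, List.not_mem_nil, false_imp_iff, implies_true, hv.iff,
      beq_iff_eq, and_true] at hvl ⊢
    exact hvl.1.trans hvl.2
  have iff_symm : ∀ {A B : Form}, HilbertDerivable (condLogic d) (A.iff B) →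
      HilbertDerivable (condLogic d) (B.iff A) := by
    intro A B h1
    refine .of_forall_mem [A.iff B] (by simp [h1]) fun v hv hvl => ?_
    simp only [List.forall_mem_cons, List.not_mem_nil, false_imp_iff, implies_true, hv.iff,
      beq_iff_eq, and_true] at hvl ⊢
    exact hvl.symm
  have hG : ∀ C, ∀ s ∈ G (P C), IsUltra (condLogic d) s ∧ (d = true → s C = true) := by
    intro C s hs
    by_cases hQ : ∃ q, P C q
    · rw [show G (P C) = W hQ.choose from dif_pos hQ] at hs
      obtain ⟨hq, hk, hC⟩ := hQ.choose_spec
      obtain ⟨h1, h2⟩ := hW _ hq hk s hs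
      refine ⟨h1, fun hd => ?_⟩
      have := h1.derivable _ hC
      rw [h1.iff, h2 hd] at this
      simpa using this
    · rw [show G (P C) = none from dif_neg hQ] at hs
      exact absurd hs (by simp)
  refine ⟨rootVal p fun C => G (P C), isUltra_rootVal _ _ (fun C s hs => (hG C s hs).1) ?_
    (fun hd C s hs => (hG C s hs).2 hd), ?_⟩
  · intro A A' hA
    congr 1
    funext q
    exact propext ⟨fun ⟨h1, h2, h3⟩ => ⟨h1, h2, iff_trans (iff_symm hA) h3⟩,
      fun ⟨h1, h2, h3⟩ => ⟨h1, h2, iff_trans hA h3⟩⟩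
  · rintro ⟨ψ, o⟩ hq hk
    simp only at hk ⊢
    induction ψ generalizing o with
    | bot => simpa [Round.coherentAt, rootVal] using hcoh _ hq
    | var n => simpa [rootVal] using hp n o hq
    | neg A ih =>
      have := ih (o + 1) (φ.occ_subset 0 _ hq (by simp [Form.occ, Form.self_mem_occ])) hk
      simpa [Round.coherentAt, rootVal, this] using hcoh _ hq
    | and A B ihA ihB =>
      simp only [Form.depth] at hk
      have h1 := ihA (o + 1) (φ.occ_subset 0 _ hq (by simp [Form.occ, Form.self_mem_occ]))
        (by omega)
      have h2 := ihB (o + 1 + A.code.length)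
        (φ.occ_subset 0 _ hq (by simp [Form.occ, Form.self_mem_occ])) (by omega)
      simpa [Round.coherentAt, rootVal, h1, h2] using hcoh _ hq
    | cond A B ihA ihB =>
      have hk' := hk
      simp only [Form.depth] at hk
      have h1 := ihA (o + 1) (Form.mem_occ_of_cond hq).1 (by omega)
      have h2 := ihB (o + 1 + A.code.length) (Form.mem_occ_of_cond hq).2 (by omega)
      have h3 := hcoh _ hq
      simp only [Round.coherentAt, h1, h2] at h3
      simp only [rootVal, Form.pos_cond]
      cases hA : rootVal p (fun C => G (P C)) A with
      | true => simpa [hA] using h3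
      | false =>
        -- The representative chosen for the class need not be `A`, but `hWc` covers every
        -- conditional whose antecedent is equivalent to it.
        have hQ : ∃ q, P A q := ⟨(A, o + 1), (Form.mem_occ_of_cond hq).1, by simp only; omega,
          .of_isBoolHom fun v hv => by simp [hv.iff]⟩
        obtain ⟨h4, h5, h6⟩ := hQ.choose_spec
        have := hWc _ h4 h5 A B o hq hk' h6
        rw [show G (P A) = W hQ.choose from dif_pos hQ]
        simpa using this

/-! ### Checking a round in one scan from right to left -/

/-- A letter of the input with its labels. -/
structure Cell where
  letter : Letter
  t : Bool
  x : Bool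
  y : Bool
  z : Bool
  u : Bool

/-- The finite part of the state of the scan. -/
structure Flags where
  prev : Option Letter
  wf : Bool
  coherent : Bool
  marked : Option Bool
  refuted : Option Bool
  successor : Bool
  vacuous : Bool
  claim : Option Bool
  started : Bool
  active : Bool
  value : Bool
  mismatch : Bool

def Flags.init : Flags := ⟨none, true, true, none, none, true, true, none, false, false, false, false⟩

def Letter.isBit : Letter → Bool
  | .bit _ => true
  | _ => false

/-- The number of immediate subformulas that a letter takes. -/
def Letter.arity : Letter → ℕ
  | .neg => 1
  | .and => 2
  | .cond => 2
  | _ => 0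

/-- One step of the scan: `p` and `q` are the labels (in the current and the next type) of the
immediate subformulas, `b` is the next digit of the marked name. -/
def Flags.update (a : Flags) (c : Cell) (p q : Option (Bool × Bool)) (b : Option Bool) : Flags :=
  match c.letter with
  | .bit i =>
    { a with
      prev := some (.bit i)
      wf := a.wf && (match a.prev with
        | some .var => i
        | some (.bit _) => true
        | _ => false)
      mismatch := a.mismatch || (a.active && b != some i) }
  | .bot =>
    { a with
      prev := some .bot
      coherent := !c.t && a.coherent
      marked := if c.x then some c.u else a.marked }
  | .var =>
    { a with
      prev := some .var
      marked := if c.x then some c.u else a.marked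
      claim := some c.y
      active := c.z && !a.started
      started := a.started || c.z
      value := if c.z && !a.started then c.t else a.value }
  | .neg =>
    { a with
      prev := some .neg
      wf := a.wf && p.isSome
      coherent := (c.t == !(p.getD default).1) && a.coherent
      marked := if c.x then some c.u else a.marked }
  | .and =>
    { a with
      prev := some .and
      wf := a.wf && q.isSome
      coherent := (c.t == ((p.getD default).1 && (q.getD default).1)) && a.coherent
      marked := if c.x then some c.u else a.marked }
  | .cond =>
    { a with
      prev := some .cond
      wf := a.wf && q.isSome
      coherent := (!(p.getD default).1 || (c.t == (q.getD default).1)) && a.coherent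
      marked := if c.x then some c.u else a.marked
      refuted := if c.z && !c.y then some (p.getD default).2 else a.refuted
      successor := (!c.y || ((q.getD default).2 == c.t)) && a.successor
      vacuous := (!c.y || c.t) && a.vacuous }

/-- The state of the scan: the finite part, the labels of the subformulas waiting for their
parent, and the remaining digits of the marked name. -/
structure Scan where
  acc : Flags
  val : List (Bool × Bool)
  name : List Bool

/-- Read from right to left, prefix notation is evaluated by a stack machine: the arguments of a
connective are on top of `val` when it is met. -/
def Scan.step (c : Cell) (s : Scan) : Scan where
  acc := s.acc.update c s.val.head? s.val.tail.head? s.name.head?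
  val := if c.letter.isBit then s.val else (c.t, c.u) :: s.val.drop c.letter.arity
  name := if c.letter.isBit && s.acc.active then s.name.tail else s.name

/-- The verdict of a round, given the finite part and whether all digits were used. -/
def Flags.verdict (d : Bool) (a : Flags) (e : Bool) : Bool :=
  a.coherent &&
  (match a.marked, a.refuted with
    | none, _ => true
    | some i, some j => i != j
    | some i, none => (a.successor && (!d || i)) || a.vacuous) &&
  (!(a.started && !a.mismatch && e) || some a.value == a.claim)

/-- The input with the labels of a round. -/
def Round.cells (ρ : Round) (w : List Letter) (o : ℕ) : List Cell :=
  (w.zipIdx o).map fun q => ⟨q.1, ρ.t q.2, ρ.x q.2, ρ.y q.2, ρ.z q.2, ρ.u q.2⟩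

theorem Round.cells_cons (ρ : Round) (a : Letter) (w : List Letter) (o : ℕ) :
    ρ.cells (a :: w) o = ⟨a, ρ.t o, ρ.x o, ρ.y o, ρ.z o, ρ.u o⟩ :: ρ.cells w (o + 1) := rfl

theorem Round.cells_append (ρ : Round) (w w' : List Letter) (o : ℕ) :
    ρ.cells (w ++ w') o = ρ.cells w o ++ ρ.cells w' (o + w.length) := by
  simp [cells, List.zipIdx_append]

/-! #### Comparison of names -/

/-- The part of the scan state that serves to compare names. -/
structure Compare where
  started : Bool
  active : Bool
  value : Bool
  mismatch : Bool
  name : List Bool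

def Scan.compare (s : Scan) : Compare :=
  ⟨s.acc.started, s.acc.active, s.acc.value, s.acc.mismatch, s.name⟩

def Compare.bit (b : Bool) (k : Compare) : Compare :=
  { k with
    mismatch := k.mismatch || (k.active && k.name.head? != some b)
    name := if k.active then k.name.tail else k.name }

/-- Only the first marked variable met, hence the rightmost one, is compared. This matches the
reversed list in `Round.varOK`. -/
def Compare.start (z t : Bool) (k : Compare) : Compare :=
  { k with
    active := z && !k.started
    started := k.started || z
    value := if z && !k.started then t else k.value }

def Compare.occ (ρ : Round) : Form × ℕ → Compare → Compare
  | (.var n, o), k =>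
    n.bits.foldr Compare.bit (k.start (ρ.z (o + n.bits.length)) (ρ.t (o + n.bits.length)))
  | _, k => k

theorem Compare.foldr_bit_of_not_active (l : List Bool) (k : Compare) (hk : k.active = false) :
    l.foldr Compare.bit k = k := by
  induction l with
  | nil => rfl
  | cons b l ih =>
    rw [List.foldr_cons, ih]
    obtain ⟨_, _, _, _, _⟩ := k
    simp_all [Compare.bit]

/-- The digits arrive most significant first, hence the reversal. An exhausted `name` counts as a
mismatch, so no mismatch means that `l.reverse` is a prefix of it; equality additionally needs an
empty remainder. -/
theorem Compare.foldr_bit_of_active (l : List Bool) (k : Compare) (hk : k.active = true)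
    (hm : k.mismatch = false) :
    (l.foldr Compare.bit k).started = k.started ∧ (l.foldr Compare.bit k).active = true ∧
    (l.foldr Compare.bit k).value = k.value ∧
    (l.foldr Compare.bit k).name = k.name.drop l.length ∧
    ((l.foldr Compare.bit k).mismatch = false ↔
      k.name = l.reverse ++ (l.foldr Compare.bit k).name) := by
  induction l with
  | nil => simp [hk, hm]
  | cons b l ih =>
    obtain ⟨h1, h2, h3, h4, h5⟩ := ih
    simp only [List.foldr_cons]
    generalize l.foldr Compare.bit k = k' at *
    refine ⟨h1, h2, h3, by simp [Compare.bit, h2, h4], ?_⟩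
    simp only [Compare.bit, h2, Bool.true_and, if_true, Bool.or_eq_false_iff, h5,
      List.reverse_cons, List.append_assoc, List.singleton_append, bne_eq_false_iff_eq]
    constructor
    · rintro ⟨h6, h7⟩
      conv_lhs => rw [h6]
      rw [List.append_cancel_left_eq]
      cases hn : k'.name with
      | nil => simp [hn] at h7
      | cons a m => simp [hn] at h7; simp [h7]
    · intro h6
      have h7 : k'.name = b :: k'.name.tail := by
        conv_lhs => rw [h4, h6]
        simp
      rw [← h7] at h6
      exact ⟨h6, by rw [h7]; rfl⟩

theorem Compare.foldr_occ (ρ : Round) (l : List (Form × ℕ)) (v : Bool) (D : List Bool) :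
    match l.reverse.findSome? ρ.variableAt with
    | none =>
      (l.foldr (Compare.occ ρ) ⟨false, false, v, false, D⟩).started = false ∧
      (l.foldr (Compare.occ ρ) ⟨false, false, v, false, D⟩).mismatch = false ∧
      (l.foldr (Compare.occ ρ) ⟨false, false, v, false, D⟩).name = D
    | some (n, b) =>
      (l.foldr (Compare.occ ρ) ⟨false, false, v, false, D⟩).started = true ∧
      (l.foldr (Compare.occ ρ) ⟨false, false, v, false, D⟩).value = b ∧
      (((l.foldr (Compare.occ ρ) ⟨false, false, v, false, D⟩).mismatch = false ∧
        (l.foldr (Compare.occ ρ) ⟨false, false, v, false, D⟩).name = []) ↔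
          D = n.bits.reverse) := by
  induction l with
  | nil => simp
  | cons q l ih =>
    rw [List.reverse_cons, List.findSome?_append, List.foldr_cons]
    generalize l.foldr (Compare.occ ρ) ⟨false, false, v, false, D⟩ = k at *
    cases hf : l.reverse.findSome? ρ.variableAt with
    | some nb =>
      obtain ⟨n, b⟩ := nb
      simp only [hf, Option.some_or] at ih ⊢
      obtain ⟨h1, h2, h3⟩ := ih
      obtain ⟨ψ, o⟩ := q
      cases ψ with
      | var m =>
        rw [Compare.occ, Compare.foldr_bit_of_not_active _ _ (by simp [Compare.start, h1])]
        simpa [Compare.start, h1, h2] using h3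
      | _ => exact ⟨h1, h2, h3⟩
    | none =>
      simp only [hf, Option.none_or] at ih ⊢
      obtain ⟨h1, h2, h3⟩ := ih
      obtain ⟨ψ, o⟩ := q
      cases ψ with
      | var m =>
        simp only [List.findSome?_cons, Round.variableAt, List.findSome?_nil]
        cases hz : ρ.z (o + m.bits.length) with
        | false =>
          rw [Compare.occ, Compare.foldr_bit_of_not_active _ _ (by simp [Compare.start, h1, hz])]
          simpa [Compare.start, h1, h2, hz] using h3
        | true =>
          obtain ⟨h4, h5, h6, h7, h8⟩ := Compare.foldr_bit_of_active m.bits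
            (k.start true (ρ.t (o + m.bits.length))) (by simp [Compare.start, h1])
            (by simp [Compare.start, h2])
          simp only [if_true, Compare.occ, hz]
          refine ⟨by rw [h4]; simp [Compare.start], by rw [h6]; simp [Compare.start, h1], ?_⟩
          rw [h8, h7]
          simp only [Compare.start, h3]
          constructor
          · rintro ⟨h9, h10⟩
            rw [h9, h10, List.append_nil]
          · rintro rfl
            simp
      | _ => exact ⟨h1, h2, h3⟩

/-! #### The scan of a code -/

/-- The effect of scanning the code of a formula with subformula occurrences `l`. -/
structure Scan.After (ρ : Round) (l : List (Form × ℕ)) (v : Bool × Bool) (h : Option Letter)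
    (s s' : Scan) : Prop where
  prev : s'.acc.prev = h
  wf : s'.acc.wf = s.acc.wf
  coherent : s'.acc.coherent = (l.all ρ.coherentAt && s.acc.coherent)
  marked : s'.acc.marked = (l.findSome? ρ.markedAt).or s.acc.marked
  refuted : s'.acc.refuted = (l.findSome? ρ.refutedAt).or s.acc.refuted
  successor : s'.acc.successor = (l.all ρ.successorAt && s.acc.successor)
  vacuous : s'.acc.vacuous = (l.all ρ.vacuousAt && s.acc.vacuous)
  claim : s'.acc.claim = (l.findSome? ρ.claimAt).or s.acc.claim
  compare : s'.compare = l.foldr (Compare.occ ρ) s.compare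
  val : s'.val = v :: s.val

/-- Binary expansions have no leading zero; this is the condition that `wf` tests at the digit next
to `var`. -/
theorem getLast_bits (n : ℕ) (h : n.bits ≠ []) : n.bits.getLast h = true := by
  induction n using Nat.binaryRec' with
  | zero => simp at h
  | bit b n hn ih =>
    have hb := Nat.bits_append_bit n b hn
    simp only [hb]
    by_cases h0 : n.bits = []
    · have : n = 0 := by
        have h1 : Form.code (.var n) = Form.code (.var 0) := by simp [Form.code, h0]
        simpa using Form.code_injective h1
      simp [h0, hn this]
    · rw [List.getLast_cons h0]
      exact ih h0

theorem Scan.foldr_bits (ρ : Round) (s : Scan) (hs : s.acc.prev = some .var) (l : List Bool)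
    (hl : ∀ h : l ≠ [], l.getLast h = true) (o : ℕ) :
    let s' := (ρ.cells (l.map Letter.bit) o).foldr Scan.step s
    s' = { s with
      acc := { s.acc with
        prev := (l.map Letter.bit ++ [Letter.var]).head?
        mismatch := (l.foldr Compare.bit s.compare).mismatch }
      name := (l.foldr Compare.bit s.compare).name } ∧
    (l.foldr Compare.bit s.compare).active = s.acc.active ∧
    (l.foldr Compare.bit s.compare).started = s.acc.started ∧
    (l.foldr Compare.bit s.compare).value = s.acc.value := by
  induction l generalizing o with
  | nil => simp [Round.cells, Scan.compare, ← hs]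
  | cons b l ih =>
    have hl' : ∀ h : l ≠ [], l.getLast h = true := fun h => by
      rw [← hl (by simp), List.getLast_cons h]
    obtain ⟨h1, h2, h3, h4⟩ := ih hl' (o + 1)
    simp only [List.map_cons, Round.cells_cons, List.foldr_cons, h1]
    refine ⟨?_, h2, h3, h4⟩
    have hb : (match (l.map Letter.bit ++ [Letter.var]).head? with
        | some .var => b
        | some (.bit _) => true
        | _ => false) = true := by
      cases l with
      | nil => simpa using hl (by simp)
      | cons a l => rfl
    simp only [Scan.step, Flags.update, hb, Bool.and_true, Letter.isBit, Bool.true_and, if_true,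
      Compare.bit, h2]
    rfl

/-- Structural induction; the second argument is scanned before the first. Flags overwritten during
the scan keep the leftmost witness, whence `findSome?` takes precedence over the earlier state in
`or`. -/
theorem Scan.after_code (ρ : Round) (φ : Form) : ∀ (o : ℕ) (s : Scan),
    Scan.After ρ (φ.occ o) (ρ.t (φ.pos o), ρ.u (φ.pos o)) φ.code.head? s
      ((ρ.cells φ.code o).foldr Scan.step s) := by
  induction φ with
  | bot =>
    intro o s
    constructor <;> simp [Form.code, Form.occ, Round.cells, Scan.step, Flags.update, Letter.isBit,
      Letter.arity, Round.coherentAt, Round.markedAt, Round.refutedAt, Round.successorAt,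
      Round.vacuousAt, Round.claimAt, Compare.occ, Scan.compare]
    cases ρ.x o <;> rfl
  | var n =>
    intro o s
    have h0 : ρ.cells (Form.var n).code o = ρ.cells (n.bits.map Letter.bit) o ++
        ρ.cells [Letter.var] (o + n.bits.length) := by
      simp [Form.code, Round.cells_append]
    rw [h0, List.foldr_append]
    have h1 : (ρ.cells [Letter.var] (o + n.bits.length)).foldr Scan.step s =
        Scan.step ⟨.var, ρ.t (o + n.bits.length), ρ.x (o + n.bits.length),
          ρ.y (o + n.bits.length), ρ.z (o + n.bits.length), ρ.u (o + n.bits.length)⟩ s := rfl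
    rw [h1]
    obtain ⟨h2, h3, h4, h5⟩ := Scan.foldr_bits ρ (Scan.step ⟨.var, ρ.t (o + n.bits.length),
      ρ.x (o + n.bits.length), ρ.y (o + n.bits.length), ρ.z (o + n.bits.length),
      ρ.u (o + n.bits.length)⟩ s) rfl n.bits (getLast_bits n) o
    rw [h2]
    have h6 : (Scan.step ⟨.var, ρ.t (o + n.bits.length),
      ρ.x (o + n.bits.length), ρ.y (o + n.bits.length), ρ.z (o + n.bits.length),
      ρ.u (o + n.bits.length)⟩ s).compare =
        s.compare.start (ρ.z (o + n.bits.length)) (ρ.t (o + n.bits.length)) := rfl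
    rw [h6] at h3 h4 h5 ⊢
    constructor
    case compare =>
      simp only [Form.occ, List.foldr_cons, List.foldr_nil, Compare.occ]
      have hk : ∀ (k : Compare) (i j v : Bool), k.started = i → k.active = j → k.value = v →
          (⟨i, j, v, k.mismatch, k.name⟩ : Compare) = k := by
        rintro k _ _ _ rfl rfl rfl
        rfl
      exact hk _ _ _ _ h4 h3 h5
    all_goals simp [Form.code, Form.occ, Scan.step, Flags.update, Letter.isBit,
      Letter.arity, Round.coherentAt, Round.markedAt, Round.refutedAt, Round.successorAt,
      Round.vacuousAt, Round.claimAt]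
    cases ρ.x (o + n.bits.length) <;> rfl
  | neg A ih =>
    intro o s
    obtain ⟨a1, a2, a3, a4, a5, a6, a7, a8, a9, a10⟩ := ih (o + 1) s
    rw [Form.code, Round.cells_cons, List.foldr_cons]
    generalize (ρ.cells A.code (o + 1)).foldr Scan.step s = s1 at *
    constructor
    case compare => exact a9
    all_goals simp [Form.occ, Scan.step, Flags.update, Letter.isBit,
      Letter.arity, Round.coherentAt, Round.markedAt, Round.refutedAt, Round.successorAt,
      Round.vacuousAt, Round.claimAt, a2, a3, a4, a5, a6, a7, a8, a10, Bool.and_assoc,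
      List.findSome?_cons]
    cases ρ.x o <;> rfl
  | and A B ihA ihB =>
    intro o s
    obtain ⟨b1, b2, b3, b4, b5, b6, b7, b8, b9, b10⟩ := ihB (o + 1 + A.code.length) s
    rw [Form.code, Round.cells_cons, Round.cells_append, List.foldr_cons, List.foldr_append]
    generalize (ρ.cells B.code (o + 1 + A.code.length)).foldr Scan.step s = s2 at *
    obtain ⟨a1, a2, a3, a4, a5, a6, a7, a8, a9, a10⟩ := ihA (o + 1) s2
    generalize (ρ.cells A.code (o + 1)).foldr Scan.step s2 = s1 at *
    constructor
    case compare =>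
      rw [Form.occ, List.foldr_cons, List.foldr_append, ← b9, ← a9]
      rfl
    all_goals simp [Form.occ, Scan.step, Flags.update, Letter.isBit,
      Letter.arity, Round.coherentAt, Round.markedAt, Round.refutedAt, Round.successorAt,
      Round.vacuousAt, Round.claimAt, a2, a3, a4, a5, a6, a7, a8, a10, b2, b3, b4, b5, b6, b7, b8,
      b10, Bool.and_assoc, List.findSome?_cons, Option.or_assoc]
    cases ρ.x o <;> simp [Option.or_assoc]
  | cond A B ihA ihB =>
    intro o s
    obtain ⟨b1, b2, b3, b4, b5, b6, b7, b8, b9, b10⟩ := ihB (o + 1 + A.code.length) s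
    rw [Form.code, Round.cells_cons, Round.cells_append, List.foldr_cons, List.foldr_append]
    generalize (ρ.cells B.code (o + 1 + A.code.length)).foldr Scan.step s = s2 at *
    obtain ⟨a1, a2, a3, a4, a5, a6, a7, a8, a9, a10⟩ := ihA (o + 1) s2
    generalize (ρ.cells A.code (o + 1)).foldr Scan.step s2 = s1 at *
    constructor
    case compare =>
      rw [Form.occ, List.foldr_cons, List.foldr_append, ← b9, ← a9]
      rfl
    all_goals simp [Form.occ, Scan.step, Flags.update, Letter.isBit,
      Letter.arity, Round.coherentAt, Round.markedAt, Round.refutedAt, Round.successorAt,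
      Round.vacuousAt, Round.claimAt, a2, a3, a4, a5, a6, a7, a8, a10, b2, b3, b4, b5, b6, b7, b8,
      b10, Bool.and_assoc, List.findSome?_cons, Option.or_assoc]
    · cases ρ.x o <;> simp [Option.or_assoc]
    · cases ρ.z o <;> cases ρ.y o <;> simp [Option.or_assoc]

theorem Scan.verdict_code (ρ : Round) (d : Bool) (φ : Form) :
    let s := (ρ.cells φ.code 0).foldr Scan.step ⟨.init, [], (ρ.digits φ.code 0).reverse⟩
    s.acc.wf = true ∧ s.val = [(ρ.t (φ.pos 0), ρ.u (φ.pos 0))] ∧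
    s.acc.verdict d s.name.isEmpty = ρ.OK d φ := by
  intro s
  obtain ⟨a1, a2, a3, a4, a5, a6, a7, a8, a9, a10⟩ :=
    Scan.after_code ρ φ 0 ⟨.init, [], (ρ.digits φ.code 0).reverse⟩
  change s.acc.wf = _ at a2
  change s.val = _ at a10
  refine ⟨a2, a10, ?_⟩
  have hv : (!(s.acc.started && !s.acc.mismatch && s.name.isEmpty) ||
      some s.acc.value == s.acc.claim) = ρ.varOK φ := by
    have h := Compare.foldr_occ ρ (φ.occ 0) false (ρ.digits φ.code 0).reverse
    change s.acc.claim = _ at a8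
    change s.compare = (φ.occ 0).foldr (Compare.occ ρ) ⟨false, false, false, false, _⟩ at a9
    rw [← a9] at h
    simp only [Scan.compare] at h
    rw [Round.varOK]
    cases hf : (φ.occ 0).reverse.findSome? ρ.variableAt with
    | none =>
      rw [hf] at h
      simp [h.1]
    | some nb =>
      obtain ⟨n, b⟩ := nb
      rw [hf] at h
      obtain ⟨h1, h2, h3⟩ := h
      simp only [h1, h2, a8, Flags.init, Option.or_none, Bool.true_and]
      congr 1
      rw [List.reverse_inj] at h3
      rw [Bool.eq_iff_iff, decide_eq_true_eq, ne_eq, ← h3]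
      cases s.acc.mismatch <;> simp
  rw [Flags.verdict, hv]
  change s.acc.coherent = _ at a3
  change s.acc.marked = _ at a4
  change s.acc.refuted = _ at a5
  change s.acc.successor = _ at a6
  change s.acc.vacuous = _ at a7
  simp only [a3, a4, a5, a6, a7, Flags.init, Option.or_none, Bool.and_true, Round.OK, Round.condOK]

/-! #### Well-formed words -/

theorem Flags.update_prev (a : Flags) (c : Cell) (p q : Option (Bool × Bool)) (b : Option Bool) :
    (a.update c p q b).prev = some c.letter := by
  obtain ⟨l, _, _, _, _, _⟩ := c
  cases l <;> rfl

/-- The invariant for arbitrary words: while `wf` holds, the suffix read so far is a concatenation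
of codes, one for each label on the stack. -/
theorem Scan.exists_forms (cs : List Cell) (D : List Bool) :
    (cs.foldr Scan.step ⟨.init, [], D⟩).acc.prev = (cs.map Cell.letter).head? ∧
    ((cs.foldr Scan.step ⟨.init, [], D⟩).acc.wf = true →
      ∃ Fs : List Form, cs.map Cell.letter = (Fs.map Form.code).flatten ∧
        Fs.length = (cs.foldr Scan.step ⟨.init, [], D⟩).val.length) := by
  induction cs with
  | nil => exact ⟨rfl, fun _ => ⟨[], rfl, rfl⟩⟩
  | cons c cs ih =>
    rw [List.foldr_cons]
    generalize cs.foldr Scan.step ⟨.init, [], D⟩ = s at *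
    obtain ⟨h1, h2⟩ := ih
    refine ⟨by simp [Scan.step, Flags.update_prev], fun hw => ?_⟩
    obtain ⟨l, t, x, y, z, u⟩ := c
    cases l with
    | bot =>
      obtain ⟨Fs, h3, h4⟩ := h2 hw
      exact ⟨.bot :: Fs, by simp [h3, Form.code],
        by simp [h4, Scan.step, Letter.isBit, Letter.arity]⟩
    | var =>
      obtain ⟨Fs, h3, h4⟩ := h2 hw
      exact ⟨.var 0 :: Fs, by simp [h3, Form.code],
        by simp [h4, Scan.step, Letter.isBit, Letter.arity]⟩
    | neg =>
      simp only [Scan.step, Flags.update, Bool.and_eq_true] at hw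
      obtain ⟨Fs, h3, h4⟩ := h2 hw.1
      rcases Fs with _ | ⟨A, Fs⟩
      · have := List.length_eq_zero_iff.1 h4.symm
        simp [this] at hw
      · exact ⟨.neg A :: Fs, by simp [h3, Form.code],
          by simp [← h4, Scan.step, Letter.isBit, Letter.arity]⟩
    | and =>
      simp only [Scan.step, Flags.update, Bool.and_eq_true] at hw
      obtain ⟨Fs, h3, h4⟩ := h2 hw.1
      obtain ⟨v, v', hv⟩ : ∃ v v', s.val = v :: v' ∧ v' ≠ [] := by
        cases hs : s.val with
        | nil => simp [hs] at hw
        | cons v v' => exact ⟨v, v', rfl, fun h => by simp [hs, h] at hw⟩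
      obtain ⟨A, B, Fs, rfl⟩ : ∃ A B Fs', Fs = A :: B :: Fs' := by
        rcases Fs with _ | ⟨A, _ | ⟨B, Fs⟩⟩
        · simp [hv.1] at h4
        · simp [hv.1] at h4; exact absurd h4 hv.2
        · exact ⟨_, _, _, rfl⟩
      exact ⟨.and A B :: Fs, by simp [h3, Form.code],
        by simp [← h4, Scan.step, Letter.isBit, Letter.arity]⟩
    | cond =>
      simp only [Scan.step, Flags.update, Bool.and_eq_true] at hw
      obtain ⟨Fs, h3, h4⟩ := h2 hw.1
      obtain ⟨v, v', hv⟩ : ∃ v v', s.val = v :: v' ∧ v' ≠ [] := by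
        cases hs : s.val with
        | nil => simp [hs] at hw
        | cons v v' => exact ⟨v, v', rfl, fun h => by simp [hs, h] at hw⟩
      obtain ⟨A, B, Fs, rfl⟩ : ∃ A B Fs', Fs = A :: B :: Fs' := by
        rcases Fs with _ | ⟨A, _ | ⟨B, Fs⟩⟩
        · simp [hv.1] at h4
        · simp [hv.1] at h4; exact absurd h4 hv.2
        · exact ⟨_, _, _, rfl⟩
      exact ⟨.cond A B :: Fs, by simp [h3, Form.code],
        by simp [← h4, Scan.step, Letter.isBit, Letter.arity]⟩
    | bit b =>
      simp only [Scan.step, Flags.update, Bool.and_eq_true] at hw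
      obtain ⟨Fs, h3, h4⟩ := h2 hw.1
      rcases Fs with _ | ⟨A, Fs⟩
      · simp only [List.map_nil, List.flatten_nil] at h3
        rw [h3] at h1
        simp [h1] at hw
      · rw [h3] at h1
        cases A with
        | var n =>
          -- A digit put before a bare `var` must be 1, otherwise the number would have a leading
          -- zero.
          have hn : n = 0 → b = true := by
            rintro rfl
            simp [Form.code] at h1
            simpa [h1] using hw.2
          exact ⟨.var (Nat.bit b n) :: Fs, by simp [h3, Form.code, Nat.bits_append_bit n b hn],
            by simp [← h4, Scan.step, Letter.isBit]⟩
        | _ => simp [Form.code] at h1; simp [h1] at hw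

theorem Scan.exists_code (cs : List Cell) (D : List Bool)
    (hw : (cs.foldr Scan.step ⟨.init, [], D⟩).acc.wf = true)
    (hv : (cs.foldr Scan.step ⟨.init, [], D⟩).val.length = 1) :
    ∃ φ : Form, cs.map Cell.letter = φ.code := by
  obtain ⟨Fs, h1, h2⟩ := (Scan.exists_forms cs D).2 hw
  rw [hv] at h2
  obtain ⟨A, rfl⟩ := List.length_eq_one_iff.1 h2
  exact ⟨A, by simpa using h1⟩

/-! ### The game as an evaluation of quantified bits -/

/-- The blocks of a play: the types `u` (and `w` for the last one), the challenges `x` and `z`,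
the claims `y`, and the marks at the beginning of each round. -/
inductive Track : Type
  | mark | u | x | y | z | w

/-- Whether the bit is chosen by the player defending satisfiability. -/
def Track.isExists : Track → Bool
  | .x => false
  | .z => false
  | _ => true

/-- Each bit comes with a letter, so every block carries its own copy of the input. -/
structure Entry where
  track : Track
  letter : Letter
  bit : Bool

/-- The value of the game in which the bits of the first list are chosen in turn, and `V` decides
about the resulting list, in reverse order. -/
def game (V : List Entry → Bool) : List Entry → List Entry → Bool
  | [], done => V done
  | e :: todo, done =>
    bif e.track.isExists then
      game V todo (⟨e.track, e.letter, false⟩ :: done) ||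
        game V todo (⟨e.track, e.letter, true⟩ :: done)
    else
      game V todo (⟨e.track, e.letter, false⟩ :: done) &&
        game V todo (⟨e.track, e.letter, true⟩ :: done)

def blankBlock (r : Track) (w : List Letter) : List Entry := w.map fun a => ⟨r, a, false⟩

def filledBlock (r : Track) (f : ℕ → Bool) (w : List Letter) (o : ℕ) : List Entry :=
  (w.zipIdx o).map fun q => ⟨r, q.1, f q.2⟩

theorem filledBlock_cons (r : Track) (f : ℕ → Bool) (a : Letter) (w : List Letter) (o : ℕ) :
    filledBlock r f (a :: w) o = ⟨r, a, f o⟩ :: filledBlock r f w (o + 1) := rfl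

theorem filledBlock_congr {r : Track} {f g : ℕ → Bool} {w : List Letter} {o : ℕ}
    (h : ∀ i, o ≤ i → f i = g i) : filledBlock r f w o = filledBlock r g w o := by
  induction w generalizing o with
  | nil => rfl
  | cons a w ih =>
    rw [filledBlock_cons, filledBlock_cons, h o le_rfl, ih fun i hi => h i (by omega)]

theorem filledBlock_update (r : Track) (f : ℕ → Bool) (b : Bool) (w : List Letter) (o : ℕ) :
    filledBlock r (Function.update f o b) w (o + 1) = filledBlock r f w (o + 1) :=
  filledBlock_congr fun i hi => Function.update_of_ne (by omega) _ _

/-- A block of existential bits is one existential quantifier over labellings. The remaining block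
never reads position `o`, so the first bit can be set there by `Function.update`. -/
theorem game_block_exists (V : List Entry → Bool) {r : Track} (hr : r.isExists = true)
    (w : List Letter) (o : ℕ) (todo done : List Entry) :
    game V (blankBlock r w ++ todo) done = true ↔
      ∃ f, game V todo ((filledBlock r f w o).reverse ++ done) = true := by
  induction w generalizing o done with
  | nil => simp [blankBlock, filledBlock]
  | cons a w ih =>
    have h1 : ∀ b done, game V (blankBlock r w ++ todo) (⟨r, a, b⟩ :: done) = true ↔ _ :=
      fun b done => ih (o + 1) (⟨r, a, b⟩ :: done)
    simp only [blankBlock, List.map_cons, List.cons_append, game, hr, cond_true, Bool.or_eq_true]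
    simp only [blankBlock] at h1
    rw [h1, h1]
    simp only [filledBlock_cons, List.reverse_cons, List.append_assoc, List.singleton_append]
    constructor
    · rintro (⟨f, hf⟩ | ⟨f, hf⟩)
      · exact ⟨Function.update f o false, by simpa [filledBlock_update] using hf⟩
      · exact ⟨Function.update f o true, by simpa [filledBlock_update] using hf⟩
    · rintro ⟨f, hf⟩
      cases hb : f o with
      | false => exact Or.inl ⟨f, by rwa [hb] at hf⟩
      | true => exact Or.inr ⟨f, by rwa [hb] at hf⟩

theorem game_block_forall (V : List Entry → Bool) {r : Track} (hr : r.isExists = false)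
    (w : List Letter) (o : ℕ) (todo done : List Entry) :
    game V (blankBlock r w ++ todo) done = true ↔
      ∀ f, game V todo ((filledBlock r f w o).reverse ++ done) = true := by
  induction w generalizing o done with
  | nil => simp [blankBlock, filledBlock]
  | cons a w ih =>
    have h1 : ∀ b done, game V (blankBlock r w ++ todo) (⟨r, a, b⟩ :: done) = true ↔ _ :=
      fun b done => ih (o + 1) (⟨r, a, b⟩ :: done)
    simp only [blankBlock, List.map_cons, List.cons_append, game, hr, cond_false,
      Bool.and_eq_true]
    simp only [blankBlock] at h1
    rw [h1, h1]
    simp only [filledBlock_cons, List.reverse_cons, List.append_assoc, List.singleton_append]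
    constructor
    · rintro ⟨hf, ht⟩ f
      cases hb : f o with
      | false => exact hf f
      | true => exact ht f
    · intro h
      exact ⟨fun f => by simpa [filledBlock_update] using h (Function.update f o false),
        fun f => by simpa [filledBlock_update] using h (Function.update f o true)⟩

/-! #### The verdict on a play -/

/-- The state of the evaluation of a play from its end: the blocks of the current round, whether
all rounds so far are won by the defender, whether the input is well-formed, and the label of the
whole formula in the current type. -/
structure Leaf where
  T : List (Letter × Bool)
  X : List Bool
  Y : List Bool
  Z : List Bool
  U : List Bool
  good : Bool
  wf : Bool
  root : Bool

def Leaf.init : Leaf := ⟨[], [], [], [], [], true, false, false⟩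

/-- The defaults make this total, as popping possibly empty stacks is; in a genuine play all blocks
have equal length. -/
def zipCells : List (Letter × Bool) → List Bool → List Bool → List Bool → List Bool → List Cell
  | [], _, _, _, _ => []
  | a :: T, X, Y, Z, U =>
    ⟨a.1, a.2, X.head?.getD false, Y.head?.getD false, Z.head?.getD false, U.head?.getD false⟩ ::
      zipCells T X.tail Y.tail Z.tail U.tail

def Cell.digit (c : Cell) : Option Bool :=
  match c.letter with
  | .bit b => if c.x then some b else none
  | _ => none

def scanCells (cs : List Cell) : Scan :=
  cs.foldr Scan.step ⟨.init, [], (cs.filterMap Cell.digit).reverse⟩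

def Leaf.cells (s : Leaf) : List Cell := zipCells s.T s.X s.Y s.Z s.U

/-- The play is read backwards, so the next type is already in `U` when a mark closes a round. The
type `T` of that round then becomes the next type of the preceding one. `wf` and `root` are
overwritten each time, so the first round of the play decides them. -/
def Leaf.step (d : Bool) (s : Leaf) (e : Entry) : Leaf :=
  match e.track with
  | .u => { s with T := (e.letter, e.bit) :: s.T }
  | .x => { s with X := e.bit :: s.X }
  | .y => { s with Y := e.bit :: s.Y }
  | .z => { s with Z := e.bit :: s.Z }
  | .w => { s with U := e.bit :: s.U }
  | .mark =>
    { T := []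
      X := s.X.drop s.T.length
      Y := s.Y.drop s.T.length
      Z := s.Z.drop s.T.length
      U := s.T.map Prod.snd ++ s.U.drop s.T.length
      good := s.good && (scanCells s.cells).acc.verdict d (scanCells s.cells).name.isEmpty
      wf := (scanCells s.cells).acc.wf && ((scanCells s.cells).val.length == 1)
      root := ((scanCells s.cells).val.head?.getD (false, false)).1 }

/-- The defender wins if the input is not well-formed, or if all rounds are won and the formula is
false at the first type. -/
def Leaf.verdict (s : Leaf) : Bool := !s.wf || (s.good && !s.root)

def leafVerdict (d : Bool) (done : List Entry) : Bool := (done.foldl (Leaf.step d) .init).verdict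

/-- A round owns no block for its next type: that is the `u` block of the following round, or the
`w` block after the last one. -/
def template (w : List Letter) : ℕ → List Entry
  | 0 => blankBlock .w w
  | k + 1 => ⟨.mark, .bot, false⟩ :: (blankBlock .u w ++ (blankBlock .x w ++ (blankBlock .y w ++
      (blankBlock .z w ++ template w k))))

def bitsOf (f : ℕ → Bool) (w : List Letter) (o : ℕ) : List Bool := (w.zipIdx o).map fun q => f q.2

def typeOf (f : ℕ → Bool) (w : List Letter) (o : ℕ) : List (Letter × Bool) :=
  (w.zipIdx o).map fun q => (q.1, f q.2)

/-! ### Evaluation of filled blocks -/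

section Blocks

variable (d : Bool) (f : ℕ → Bool) (w : List Letter) (o : ℕ) (s : Leaf)

theorem Leaf.foldl_u : (filledBlock .u f w o).reverse.foldl (Leaf.step d) s =
    { s with T := typeOf f w o ++ s.T } := by
  rw [List.foldl_reverse]
  induction w generalizing o with
  | nil => rfl
  | cons a w ih => rw [filledBlock_cons, List.foldr_cons, ih]; rfl

theorem Leaf.foldl_x : (filledBlock .x f w o).reverse.foldl (Leaf.step d) s =
    { s with X := bitsOf f w o ++ s.X } := by
  rw [List.foldl_reverse]
  induction w generalizing o with
  | nil => rfl
  | cons a w ih => rw [filledBlock_cons, List.foldr_cons, ih]; rfl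

theorem Leaf.foldl_y : (filledBlock .y f w o).reverse.foldl (Leaf.step d) s =
    { s with Y := bitsOf f w o ++ s.Y } := by
  rw [List.foldl_reverse]
  induction w generalizing o with
  | nil => rfl
  | cons a w ih => rw [filledBlock_cons, List.foldr_cons, ih]; rfl

theorem Leaf.foldl_z : (filledBlock .z f w o).reverse.foldl (Leaf.step d) s =
    { s with Z := bitsOf f w o ++ s.Z } := by
  rw [List.foldl_reverse]
  induction w generalizing o with
  | nil => rfl
  | cons a w ih => rw [filledBlock_cons, List.foldr_cons, ih]; rfl

theorem Leaf.foldl_w : (filledBlock .w f w o).reverse.foldl (Leaf.step d) s =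
    { s with U := bitsOf f w o ++ s.U } := by
  rw [List.foldl_reverse]
  induction w generalizing o with
  | nil => rfl
  | cons a w ih => rw [filledBlock_cons, List.foldr_cons, ih]; rfl

end Blocks

theorem zipCells_letters (T : List (Letter × Bool)) : ∀ X Y Z U : List Bool,
    (zipCells T X Y Z U).map Cell.letter = T.map Prod.fst := by
  induction T with
  | nil => intros; rfl
  | cons a T ih => intro X Y Z U; simp [zipCells, ih]

theorem typeOf_letters (f : ℕ → Bool) (w : List Letter) (o : ℕ) :
    (typeOf f w o).map Prod.fst = w := by
  simp only [typeOf, List.map_map]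
  exact List.zipIdx_map_fst o w

theorem typeOf_bits (f : ℕ → Bool) (w : List Letter) (o : ℕ) :
    (typeOf f w o).map Prod.snd = bitsOf f w o := by
  simp [typeOf, bitsOf]

theorem zipCells_blocks (ρ : Round) (w : List Letter) (o : ℕ) :
    zipCells (typeOf ρ.t w o) (bitsOf ρ.x w o) (bitsOf ρ.y w o) (bitsOf ρ.z w o)
      (bitsOf ρ.u w o) = ρ.cells w o := by
  induction w generalizing o with
  | nil => rfl
  | cons a w ih =>
    have := ih (o + 1)
    simp only [typeOf, bitsOf, List.zipIdx_cons, List.map_cons, zipCells, List.head?_cons,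
      Option.getD_some, List.tail_cons, Round.cells_cons] at this ⊢
    rw [this]

theorem Round.filterMap_digit_cells (ρ : Round) (w : List Letter) (o : ℕ) :
    (ρ.cells w o).filterMap Cell.digit = ρ.digits w o := by
  rw [cells, List.filterMap_map, digits]
  congr 1
  funext ⟨a, i⟩
  cases a <;> rfl

/-- Type elimination with `k` rounds left. -/
def Sat (d : Bool) (φ : Form) : ℕ → (ℕ → Bool) → Prop
  | 0, _ => True
  | k + 1, t => ∀ x, ∃ y, ∀ z, ∃ u, Round.OK ⟨t, x, y, z, u⟩ d φ = true ∧ Sat d φ k u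

theorem Sat.of_represents {d : Bool} {φ : Form} (k : ℕ) : ∀ {v : Form → Bool} {t : ℕ → Bool},
    IsUltra (condLogic d) v → Represents φ v t → Sat d φ k t := by
  induction k with
  | zero => intros; trivial
  | succ k ih =>
    intro v t hv ht x
    obtain ⟨y, hy⟩ := round_sound hv ht x
    refine ⟨y, fun z => ?_⟩
    obtain ⟨u, v', hv', hu, hOK⟩ := hy z
    exact ⟨u, hOK, ih hv' hu⟩

theorem Sat.agreesBelow {d : Bool} {φ : Form} (k : ℕ) : ∀ {t : ℕ → Bool},
    Sat d φ k t → AgreesBelow d φ k t := by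
  induction k with
  | zero =>
    intro t _
    obtain ⟨v, hv⟩ := exists_isUltra_condLogic d
    exact ⟨v, hv, fun q _ hq => absurd hq (Nat.not_lt_zero _)⟩
  | succ k ih =>
    intro t ht
    refine round_complete fun x => ?_
    obtain ⟨y, hy⟩ := ht x
    refine ⟨y, fun z => ?_⟩
    obtain ⟨u, hu, hs⟩ := hy z
    exact ⟨u, hu, ih hs⟩

/-- With as many rounds as letters, agreement reaches `φ` itself, whose depth is smaller than its
length. -/
theorem derivable_iff_sat (d : Bool) (φ : Form) : HilbertDerivable (condLogic d) φ ↔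
    ∀ t, Sat d φ φ.code.length t → t (φ.pos 0) = true := by
  constructor
  · intro h t ht
    obtain ⟨v, hv, hvt⟩ := ht.agreesBelow
    rw [hvt _ (φ.self_mem_occ 0) φ.depth_lt_length_code]
    exact hv.derivable _ h
  · intro h
    by_contra hφ
    obtain ⟨v, hv, hvφ⟩ := exists_isUltra_of_not_derivable hφ
    obtain ⟨t, ht⟩ := exists_represents φ v
    have h1 := h t (Sat.of_represents _ hv ht)
    rw [ht _ (φ.self_mem_occ 0), hvφ] at h1
    exact Bool.false_ne_true h1

/-- The state of the evaluation of a play after its last `k` rounds. -/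
def leafAfter (φ : Form) (k : ℕ) (u : ℕ → Bool) (g : Bool) : Leaf :=
  ⟨[], [], [], [], bitsOf u φ.code 0, g, decide (0 < k), decide (0 < k) && u (φ.pos 0)⟩

theorem Leaf.foldl_round (d : Bool) (φ : Form) (k : ℕ) (t x y z u : ℕ → Bool) (g : Bool)
    (done : List Entry) :
    ((filledBlock .z z φ.code 0).reverse ++ ((filledBlock .y y φ.code 0).reverse ++
      ((filledBlock .x x φ.code 0).reverse ++ ((filledBlock .u t φ.code 0).reverse ++
        ⟨.mark, .bot, false⟩ :: done)))).foldl (Leaf.step d) (leafAfter φ k u g) =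
    done.foldl (Leaf.step d) (leafAfter φ (k + 1) t (g && Round.OK ⟨t, x, y, z, u⟩ d φ)) := by
  rw [List.foldl_append, Leaf.foldl_z, List.foldl_append, Leaf.foldl_y, List.foldl_append,
    Leaf.foldl_x, List.foldl_append, Leaf.foldl_u, List.foldl_cons]
  congr 1
  have hc := zipCells_blocks ⟨t, x, y, z, u⟩ φ.code 0
  obtain ⟨h1, h2, h3⟩ := Scan.verdict_code ⟨t, x, y, z, u⟩ d φ
  have hl : ∀ f : ℕ → Bool, (bitsOf f φ.code 0).length = φ.code.length := by simp [bitsOf]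
  have hl' : (typeOf t φ.code 0).length = φ.code.length := by simp [typeOf]
  have hs : scanCells (zipCells (typeOf t φ.code 0) (bitsOf x φ.code 0) (bitsOf y φ.code 0)
      (bitsOf z φ.code 0) (bitsOf u φ.code 0)) = (Round.cells ⟨t, x, y, z, u⟩ φ.code 0).foldr
        Scan.step ⟨.init, [], (Round.digits ⟨t, x, y, z, u⟩ φ.code 0).reverse⟩ := by
    rw [scanCells, hc, Round.filterMap_digit_cells]
  simp only [Leaf.step, leafAfter, Leaf.cells, List.append_nil, hs, h1, h2, h3, hl,
    hl', typeOf_bits]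
  simp [hl]

/-- The verdict comes only at the end of a play, whereas `Sat` tests each round at once. The
hypothesis, that a lost round makes the whole play lost, allows the tests to be moved inside the
quantifiers. -/
theorem game_template_code (d : Bool) (φ : Form) (k : ℕ) : ∀ done : List Entry,
    (∀ u, (done.foldl (Leaf.step d) (leafAfter φ k u false)).verdict = false) →
    (game (leafVerdict d) (template φ.code k) done = true ↔
      ∃ u, Sat d φ k u ∧ (done.foldl (Leaf.step d) (leafAfter φ k u true)).verdict = true) := by
  induction k with
  | zero =>
    intro done _
    have h := game_block_exists (leafVerdict d) (r := .w) rfl φ.code 0 [] done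
    rw [List.append_nil] at h
    rw [template, h]
    refine exists_congr fun f => ?_
    simp only [game, leafVerdict, List.foldl_append, Leaf.foldl_w, Sat, true_and]
    simp [leafAfter, Leaf.init]
  | succ k ih =>
    intro done hdone
    -- A mark is formally an existential bit, but its value is never read, so both branches agree.
    have hmark : game (leafVerdict d) (template φ.code (k + 1)) done = true ↔
        game (leafVerdict d) (blankBlock .u φ.code ++ (blankBlock .x φ.code ++
          (blankBlock .y φ.code ++ (blankBlock .z φ.code ++ template φ.code k))))
            (⟨.mark, .bot, false⟩ :: done) = true ∨
        game (leafVerdict d) (blankBlock .u φ.code ++ (blankBlock .x φ.code ++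
          (blankBlock .y φ.code ++ (blankBlock .z φ.code ++ template φ.code k))))
            (⟨.mark, .bot, true⟩ :: done) = true := by
      rw [template, game]
      simp [Track.isExists]
    have hrec : ∀ b, game (leafVerdict d) (blankBlock .u φ.code ++ (blankBlock .x φ.code ++
          (blankBlock .y φ.code ++ (blankBlock .z φ.code ++ template φ.code k))))
            (⟨.mark, .bot, b⟩ :: done) = true ↔
        ∃ u, Sat d φ (k + 1) u ∧
          (done.foldl (Leaf.step d) (leafAfter φ (k + 1) u true)).verdict = true := by
      intro b
      have hround : ∀ t x y z u g, ((filledBlock .z z φ.code 0).reverse ++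
          ((filledBlock .y y φ.code 0).reverse ++ ((filledBlock .x x φ.code 0).reverse ++
            ((filledBlock .u t φ.code 0).reverse ++ ⟨.mark, .bot, b⟩ :: done)))).foldl
              (Leaf.step d) (leafAfter φ k u g) =
          done.foldl (Leaf.step d)
            (leafAfter φ (k + 1) t (g && Round.OK ⟨t, x, y, z, u⟩ d φ)) := by
        intro t x y z u g
        rw [← Leaf.foldl_round]
        simp only [List.foldl_append, List.foldl_cons]
        rfl
      rw [game_block_exists _ rfl _ 0]
      refine exists_congr fun t => ?_
      have hstep : ∀ x y z, game (leafVerdict d) (template φ.code k)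
          ((filledBlock .z z φ.code 0).reverse ++
          ((filledBlock .y y φ.code 0).reverse ++ ((filledBlock .x x φ.code 0).reverse ++
            ((filledBlock .u t φ.code 0).reverse ++ ⟨.mark, .bot, b⟩ :: done)))) = true ↔
          ∃ u, (Round.OK ⟨t, x, y, z, u⟩ d φ = true ∧ Sat d φ k u) ∧
            (done.foldl (Leaf.step d) (leafAfter φ (k + 1) t true)).verdict = true := by
        intro x y z
        -- A loss in a later round persists through the present one.
        rw [ih _ fun u => by rw [hround, Bool.false_and]; exact hdone t]
        refine exists_congr fun u => ?_
        rw [hround, Bool.true_and]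
        cases hOK : Round.OK ⟨t, x, y, z, u⟩ d φ with
        | false => simp [hdone t]
        | true => simp
      rw [game_block_forall _ rfl _ 0, Sat]
      constructor
      · intro h
        have h' : ∀ x, ∃ y, ∀ z, ∃ u, (Round.OK ⟨t, x, y, z, u⟩ d φ = true ∧ Sat d φ k u) ∧
            (done.foldl (Leaf.step d) (leafAfter φ (k + 1) t true)).verdict = true := by
          intro x
          obtain ⟨y, hy⟩ := (game_block_exists _ rfl _ 0 _ _).1 (h x)
          refine ⟨y, fun z => ?_⟩
          exact (hstep x y z).1 ((game_block_forall _ rfl _ 0 _ _).1 hy z)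
        refine ⟨fun x => ?_, ?_⟩
        · obtain ⟨y, hy⟩ := h' x
          exact ⟨y, fun z => (hy z).imp fun u hu => hu.1⟩
        -- The remaining verdict does not depend on the challenges; `t` is merely some labelling.
        · obtain ⟨y, hy⟩ := h' t
          obtain ⟨u, hu⟩ := hy t
          exact hu.2
      · rintro ⟨h1, h2⟩ x
        obtain ⟨y, hy⟩ := h1 x
        rw [game_block_exists _ rfl _ 0]
        refine ⟨y, ?_⟩
        rw [game_block_forall _ rfl _ 0]
        intro z
        rw [hstep]
        exact (hy z).imp fun u hu => ⟨hu, h2⟩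
    rw [hmark, hrec, hrec, or_self]

/-- Every check finds the word ill-formed, whatever the labels, and an ill-formed word is a win for
the defender; constant answers suffice. -/
theorem game_template_of_not_code (d : Bool) {w : List Letter} (hw : ∀ φ : Form, w ≠ φ.code)
    (k : ℕ) : ∀ done : List Entry,
    (∀ s : Leaf, s.wf = false → s.T = [] →
      (done.foldl (Leaf.step d) s).verdict = true) →
    game (leafVerdict d) (template w k) done = true := by
  induction k with
  | zero =>
    intro done hdone
    have h := game_block_exists (leafVerdict d) (r := .w) rfl w 0 [] done
    rw [List.append_nil] at h
    rw [template, h]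
    refine ⟨fun _ => false, ?_⟩
    simp only [game, leafVerdict, List.foldl_append, Leaf.foldl_w]
    exact hdone _ rfl rfl
  | succ k ih =>
    intro done hdone
    rw [template, game]
    simp only [Track.isExists, cond_true, Bool.or_eq_true]
    left
    rw [game_block_exists _ rfl _ 0]
    refine ⟨fun _ => false, ?_⟩
    rw [game_block_forall _ rfl _ 0]
    intro x
    rw [game_block_exists _ rfl _ 0]
    refine ⟨fun _ => false, ?_⟩
    rw [game_block_forall _ rfl _ 0]
    intro z
    refine ih _ fun s hs hT => ?_
    rw [List.foldl_append, Leaf.foldl_z, List.foldl_append, Leaf.foldl_y, List.foldl_append,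
      Leaf.foldl_x, List.foldl_append, Leaf.foldl_u, List.foldl_cons]
    refine hdone _ ?_ rfl
    simp only [Leaf.step, Leaf.cells, hT, List.append_nil]
    rw [← Bool.not_eq_true, Bool.and_eq_true, beq_iff_eq]
    rintro ⟨h1, h2⟩
    obtain ⟨φ, hφ⟩ := Scan.exists_code _ _ h1 h2
    rw [zipCells_letters, typeOf_letters] at hφ
    exact hw φ hφ

theorem game_template (d : Bool) (w : List Letter) :
    game (leafVerdict d) (template w w.length) [] = false ↔
      w ∈ provabilityProblem (condLogic d) := by
  by_cases hw : ∃ φ : Form, w = φ.code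
  · obtain ⟨φ, rfl⟩ := hw
    have hpos : 0 < φ.code.length := lt_of_le_of_lt (Nat.zero_le _) φ.depth_lt_length_code
    have h1 : φ.code ∈ provabilityProblem (condLogic d) ↔ HilbertDerivable (condLogic d) φ := by
      constructor
      · rintro ⟨A, hA, hc⟩
        rwa [Form.code_injective hc]
      · exact fun h => ⟨φ, h, rfl⟩
    rw [h1, derivable_iff_sat, ← Bool.not_eq_true, game_template_code d φ _ []
      (fun u => by simp [leafAfter, Leaf.verdict, hpos])]
    simp [leafAfter, Leaf.verdict, hpos]
  · push Not at hw
    rw [game_template_of_not_code d hw _ [] fun s hs _ => by simp [Leaf.verdict, hs]]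
    simp only [Bool.true_eq_false, false_iff]
    rintro ⟨A, -, hA⟩
    exact hw A hA

/-! ### The machine -/

/-- The stacks of the machine. -/
inductive StackName : Type
  | inp | out | aux | cnt | todo | done | T | X | Y | Z | U | zip | val | name
  deriving DecidableEq

namespace StackName

def all : List StackName := [inp, out, aux, cnt, todo, done, T, X, Y, Z, U, zip, val, name]

instance : Fintype StackName where
  elems := ⟨all, by decide⟩
  complete k := by cases k <;> decide

@[reducible] def Γ : StackName → Type
  | inp => Letter
  | out => Bool
  | aux => Letter
  | cnt => Bool
  | todo => Entry
  | done => Entry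
  | T => Letter × Bool
  | X => Bool
  | Y => Bool
  | Z => Bool
  | U => Bool
  | zip => Cell
  | val => Bool × Bool
  | name => Bool

end StackName

/-- The contents of the stacks. -/
structure Stacks where
  inp : List Letter := []
  out : List Bool := []
  aux : List Letter := []
  cnt : List Bool := []
  todo : List Entry := []
  done : List Entry := []
  T : List (Letter × Bool) := []
  X : List Bool := []
  Y : List Bool := []
  Z : List Bool := []
  U : List Bool := []
  zip : List Cell := []
  val : List (Bool × Bool) := []
  name : List Bool := []

namespace Stacks

def fn (s : Stacks) : ∀ k : StackName, List k.Γ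
  | .inp => s.inp
  | .out => s.out
  | .aux => s.aux
  | .cnt => s.cnt
  | .todo => s.todo
  | .done => s.done
  | .T => s.T
  | .X => s.X
  | .Y => s.Y
  | .Z => s.Z
  | .U => s.U
  | .zip => s.zip
  | .val => s.val
  | .name => s.name

def size (s : Stacks) : ℕ :=
  s.inp.length + s.out.length + s.aux.length + s.cnt.length + s.todo.length + s.done.length +
    s.T.length + s.X.length + s.Y.length + s.Z.length + s.U.length + s.zip.length + s.val.length +
    s.name.length

variable (s : Stacks)

@[simp] theorem fn_inp : s.fn .inp = s.inp := rfl
@[simp] theorem fn_out : s.fn .out = s.out := rfl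
@[simp] theorem fn_aux : s.fn .aux = s.aux := rfl
@[simp] theorem fn_cnt : s.fn .cnt = s.cnt := rfl
@[simp] theorem fn_todo : s.fn .todo = s.todo := rfl
@[simp] theorem fn_done : s.fn .done = s.done := rfl
@[simp] theorem fn_T : s.fn .T = s.T := rfl
@[simp] theorem fn_X : s.fn .X = s.X := rfl
@[simp] theorem fn_Y : s.fn .Y = s.Y := rfl
@[simp] theorem fn_Z : s.fn .Z = s.Z := rfl
@[simp] theorem fn_U : s.fn .U = s.U := rfl
@[simp] theorem fn_zip : s.fn .zip = s.zip := rfl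
@[simp] theorem fn_val : s.fn .val = s.val := rfl
@[simp] theorem fn_name : s.fn .name = s.name := rfl

-- These rules turn updates of the dependent function into record updates, so that `simp` can
-- execute the program.
@[simp] theorem update_inp (l : List Letter) :
    Function.update s.fn .inp l = ({ s with inp := l } : Stacks).fn := by
  funext k; cases k <;> simp [Function.update, fn]
@[simp] theorem update_out (l : List Bool) :
    Function.update s.fn .out l = ({ s with out := l } : Stacks).fn := by
  funext k; cases k <;> simp [Function.update, fn]
@[simp] theorem update_aux (l : List Letter) :
    Function.update s.fn .aux l = ({ s with aux := l } : Stacks).fn := by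
  funext k; cases k <;> simp [Function.update, fn]
@[simp] theorem update_cnt (l : List Bool) :
    Function.update s.fn .cnt l = ({ s with cnt := l } : Stacks).fn := by
  funext k; cases k <;> simp [Function.update, fn]
@[simp] theorem update_todo (l : List Entry) :
    Function.update s.fn .todo l = ({ s with todo := l } : Stacks).fn := by
  funext k; cases k <;> simp [Function.update, fn]
@[simp] theorem update_done (l : List Entry) :
    Function.update s.fn .done l = ({ s with done := l } : Stacks).fn := by
  funext k; cases k <;> simp [Function.update, fn]
@[simp] theorem update_T (l : List (Letter × Bool)) :
    Function.update s.fn .T l = ({ s with T := l } : Stacks).fn := by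
  funext k; cases k <;> simp [Function.update, fn]
@[simp] theorem update_X (l : List Bool) :
    Function.update s.fn .X l = ({ s with X := l } : Stacks).fn := by
  funext k; cases k <;> simp [Function.update, fn]
@[simp] theorem update_Y (l : List Bool) :
    Function.update s.fn .Y l = ({ s with Y := l } : Stacks).fn := by
  funext k; cases k <;> simp [Function.update, fn]
@[simp] theorem update_Z (l : List Bool) :
    Function.update s.fn .Z l = ({ s with Z := l } : Stacks).fn := by
  funext k; cases k <;> simp [Function.update, fn]
@[simp] theorem update_U (l : List Bool) :
    Function.update s.fn .U l = ({ s with U := l } : Stacks).fn := by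
  funext k; cases k <;> simp [Function.update, fn]
@[simp] theorem update_zip (l : List Cell) :
    Function.update s.fn .zip l = ({ s with zip := l } : Stacks).fn := by
  funext k; cases k <;> simp [Function.update, fn]
@[simp] theorem update_val (l : List (Bool × Bool)) :
    Function.update s.fn .val l = ({ s with val := l } : Stacks).fn := by
  funext k; cases k <;> simp [Function.update, fn]
@[simp] theorem update_name (l : List Bool) :
    Function.update s.fn .name l = ({ s with name := l } : Stacks).fn := by
  funext k; cases k <;> simp [Function.update, fn]

end Stacks

/-- Scratch registers, cleared at every jump. -/
structure Scratch where
  letter : Option Letter := none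
  entry : Option Entry := none
  typ : Option (Letter × Bool) := none
  x : Option Bool := none
  y : Option Bool := none
  z : Option Bool := none
  u : Option Bool := none
  cell : Option Cell := none
  p : Option (Bool × Bool) := none
  q : Option (Bool × Bool) := none
  digit : Option Bool := none

/-- The registers of the machine. -/
structure Reg where
  tmp : Scratch := {}
  track : Track := .w
  flags : Flags := .init
  good : Bool := true
  wf : Bool := false
  root : Bool := false
  value : Bool := false

inductive Label : Type
  | load | copy | restore | count | clear | down | leaf | zip | scan | clearVal | clearName
  | wipe | rest | up | fin

open Turing TM2 Stmt

abbrev MStmt := Stmt StackName.Γ Label Reg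

/-- Clearing the scratch registers lets every loop invariant start from `tmp = {}`. -/
def jump (l : Label) : MStmt := Stmt.load (fun r => { r with tmp := {} }) (goto fun _ => l)

@[simp] def setLetter (r : Reg) (a : Option Letter) : Reg := { r with tmp := { r.tmp with letter := a } }
@[simp] def setEntry (r : Reg) (a : Option Entry) : Reg := { r with tmp := { r.tmp with entry := a } }
@[simp] def setTyp (r : Reg) (a : Option (Letter × Bool)) : Reg := { r with tmp := { r.tmp with typ := a } }
@[simp] def setX (r : Reg) (a : Option Bool) : Reg := { r with tmp := { r.tmp with x := a } }
@[simp] def setY (r : Reg) (a : Option Bool) : Reg := { r with tmp := { r.tmp with y := a } }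
@[simp] def setZ (r : Reg) (a : Option Bool) : Reg := { r with tmp := { r.tmp with z := a } }
@[simp] def setU (r : Reg) (a : Option Bool) : Reg := { r with tmp := { r.tmp with u := a } }
@[simp] def setCell (r : Reg) (a : Option Cell) : Reg := { r with tmp := { r.tmp with cell := a } }
@[simp] def setP (r : Reg) (a : Option (Bool × Bool)) : Reg := { r with tmp := { r.tmp with p := a } }
@[simp] def setQ (r : Reg) (a : Option (Bool × Bool)) : Reg := { r with tmp := { r.tmp with q := a } }
@[simp] def setDigit (r : Reg) (a : Option Bool) : Reg := { r with tmp := { r.tmp with digit := a } }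

namespace Reg

@[simp] def theLetter (r : Reg) : Letter := r.tmp.letter.getD .bot
@[simp] def theEntry (r : Reg) : Entry := r.tmp.entry.getD ⟨.mark, .bot, false⟩
@[simp] def theCell (r : Reg) : Cell := r.tmp.cell.getD ⟨.bot, false, false, false, false, false⟩

@[simp] def readCell (r : Reg) : Reg :=
  setCell r (some ⟨(r.tmp.typ.getD (.bot, false)).1, (r.tmp.typ.getD (.bot, false)).2,
    r.tmp.x.getD false, r.tmp.y.getD false, r.tmp.z.getD false, r.tmp.u.getD false⟩)

def updateFlags (r : Reg) : Reg :=
  { r with flags := r.flags.update r.theCell r.tmp.p r.tmp.q r.tmp.digit }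

def finishRound (d : Bool) (r : Reg) : Reg :=
  { r with
    good := r.good && r.flags.verdict d r.tmp.digit.isNone
    wf := r.flags.wf && (r.tmp.p.isSome && r.tmp.q.isNone)
    root := (r.tmp.p.getD (false, false)).1 }

end Reg

def Track.toNat : Track → ℕ
  | .mark => 0
  | .u => 1
  | .x => 2
  | .y => 3
  | .z => 4
  | .w => 5

/-- The block that precedes a given one in a round. -/
def Track.pred : Track → Track
  | .z => .y
  | .y => .x
  | _ => .u

def Letter.isUnaryOrBinary (a : Letter) : Bool := decide (1 ≤ a.arity)
def Letter.isBinary (a : Letter) : Bool := decide (2 ≤ a.arity)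

/-- The part of the scan after the labels of the subformulas have been read. -/
def scanTail : MStmt :=
  Stmt.load Reg.updateFlags <|
  -- The current labels are handed on as the next type of the preceding round.
  push .U (fun r => r.theCell.t) <|
  branch (fun r => r.theCell.letter.isBit) (jump .scan) <|
  push .val (fun r => (r.theCell.t, r.theCell.u)) <|
  jump .scan

/-- The program. -/
def program (d : Bool) : Label → MStmt
  | .load =>
    pop .inp setLetter <|
    branch (fun r => r.tmp.letter.isSome)
      (push .aux Reg.theLetter <| push .cnt (fun _ => true) <| jump .load)
      (Stmt.load (fun r => { r with track := .w }) <| jump .copy)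
  | .copy =>
    pop .aux setLetter <|
    branch (fun r => r.tmp.letter.isSome)
      (push .todo (fun r => ⟨r.track, r.theLetter, false⟩) <| push .inp Reg.theLetter <|
        jump .copy)
      (jump .restore)
  | .restore =>
    pop .inp setLetter <|
    branch (fun r => r.tmp.letter.isSome)
      (push .aux Reg.theLetter <| jump .restore) <|
    -- The list is built from its end: the lone `w` block (5) comes first, and each round ends with
    -- its `u` block (1) and the mark.
    branch (fun r => decide (r.track.toNat = 5)) (jump .count) <|
    branch (fun r => decide (r.track.toNat = 1))
      (push .todo (fun _ => ⟨.mark, .bot, false⟩) <| jump .count) <|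
    Stmt.load (fun r => { r with track := r.track.pred }) <| jump .copy
  | .count =>
    pop .cnt setDigit <|
    branch (fun r => r.tmp.digit.isSome)
      (Stmt.load (fun r => { r with track := .z }) <| jump .copy)
      (jump .clear)
  | .clear =>
    pop .aux setLetter <|
    branch (fun r => r.tmp.letter.isSome) (jump .clear) (jump .down)
  | .down =>
    pop .todo setEntry <|
    branch (fun r => r.tmp.entry.isSome)
      (push .done (fun r => ⟨r.theEntry.track, r.theEntry.letter, false⟩) <| jump .down)
      (Stmt.load (fun r => { r with good := true, wf := false, root := false }) <| jump .leaf)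
  | .leaf =>
    pop .done setEntry <|
    branch (fun r => r.tmp.entry.isSome)
      (push .todo Reg.theEntry <|
        branch (fun r => decide (r.theEntry.track.toNat = 1))
          (push .T (fun r => (r.theEntry.letter, r.theEntry.bit)) <| jump .leaf) <|
        branch (fun r => decide (r.theEntry.track.toNat = 2))
          (push .X (fun r => r.theEntry.bit) <| jump .leaf) <|
        branch (fun r => decide (r.theEntry.track.toNat = 3))
          (push .Y (fun r => r.theEntry.bit) <| jump .leaf) <|
        branch (fun r => decide (r.theEntry.track.toNat = 4))
          (push .Z (fun r => r.theEntry.bit) <| jump .leaf) <|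
        branch (fun r => decide (r.theEntry.track.toNat = 5))
          (push .U (fun r => r.theEntry.bit) <| jump .leaf) <|
        Stmt.load (fun r => { r with flags := .init }) <| jump .zip)
      (jump .wipe)
  | .zip =>
    pop .T setTyp <|
    branch (fun r => r.tmp.typ.isSome)
      (pop .X setX <| pop .Y setY <| pop .Z setZ <| pop .U setU <| Stmt.load Reg.readCell <|
        push .zip Reg.theCell <|
        branch (fun r => r.theCell.digit.isSome)
          (push .name (fun r => r.theCell.digit.getD false) <| jump .zip)
          (jump .zip))
      (jump .scan)
  | .scan =>
    pop .zip setCell <|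
    branch (fun r => r.tmp.cell.isSome)
      (branch (fun r => r.theCell.letter.isBit && r.flags.active)
        (pop .name setDigit <| scanTail) <|
      branch (fun r => r.theCell.letter.isBinary)
        (pop .val setP <| pop .val setQ <| scanTail) <|
      branch (fun r => r.theCell.letter.isUnaryOrBinary)
        (pop .val setP <| scanTail)
        scanTail)
      -- Popping once from `name` and twice from `val` tests whether the name is used up and whether
      -- exactly one label is left.
      (pop .name setDigit <| pop .val setP <| pop .val setQ <|
        Stmt.load (Reg.finishRound d) <| jump .clearVal)
  | .clearVal =>
    pop .val setP <|
    branch (fun r => r.tmp.p.isSome) (jump .clearVal) (jump .clearName)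
  | .clearName =>
    pop .name setDigit <|
    branch (fun r => r.tmp.digit.isSome) (jump .clearName) (jump .leaf)
  | .wipe =>
    pop .T setTyp <| pop .X setX <| pop .Y setY <| pop .Z setZ <| pop .U setU <|
    branch (fun r => r.tmp.typ.isSome || r.tmp.x.isSome || r.tmp.y.isSome || r.tmp.z.isSome ||
        r.tmp.u.isSome)
      (jump .wipe)
      (Stmt.load (fun r => { r with value := !r.wf || (r.good && !r.root) }) <| jump .rest)
  | .rest =>
    pop .todo setEntry <|
    branch (fun r => r.tmp.entry.isSome) (push .done Reg.theEntry <| jump .rest) (jump .up)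
  | .up =>
    pop .done setEntry <|
    branch (fun r => r.tmp.entry.isSome)
      -- The second value of a bit is tried only if the first did not settle the quantifier.
      -- Otherwise the bit is reset to `false` and the search moves up.
      (branch (fun r => !r.theEntry.bit && (r.theEntry.track.isExists != r.value))
        (push .done (fun r => ⟨r.theEntry.track, r.theEntry.letter, true⟩) <| jump .down)
        (push .todo (fun r => ⟨r.theEntry.track, r.theEntry.letter, false⟩) <| jump .up))
      (jump .fin)
  | .fin =>
    pop .todo setEntry <|
    branch (fun r => r.tmp.entry.isSome) (jump .fin)
      (push .out (fun r => !r.value) <| Stmt.load (fun _ => {}) halt)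

/-! #### Reachability in bounded space -/

abbrev MCfg := Cfg StackName.Γ Label Reg

def config (l : Label) (r : Reg) (s : Stacks) : MCfg := ⟨some l, r, s.fn⟩

/-- One configuration is reached from another through configurations of size at most `B`. -/
def Reach (d : Bool) (B : ℕ) : MCfg → MCfg → Prop :=
  Relation.ReflTransGen fun a b =>
    TM2.step (program d) a = some b ∧ ∑ k, (b.stk k).length ≤ B

theorem Stacks.sum_length_fn (s : Stacks) : ∑ k, (s.fn k).length = s.size := by
  -- The `Fintype` instance enumerates by `StackName.all`, so the sum is by definition a sum over
  -- this list.
  change (StackName.all.map fun k => (s.fn k).length).sum = _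
  simp [StackName.all, Stacks.fn, Stacks.size]
  omega

theorem Reach.step {d : Bool} {B : ℕ} {l l' : Label} {r r' : Reg} {s s' : Stacks} {c : MCfg}
    (h : TM2.step (program d) (config l r s) = some (config l' r' s')) (hB : s'.size ≤ B)
    (hc : Reach d B (config l' r' s') c) : Reach d B (config l r s) c :=
  .head ⟨h, by rw [← s'.sum_length_fn] at hB; exact hB⟩ hc

@[simp] theorem stepAux_jump (l : Label) (r : Reg) (s : Stacks) :
    stepAux (jump l) r s.fn = config l { r with tmp := {} } s := rfl

@[simp] theorem step_config (d : Bool) (l : Label) (r : Reg) (s : Stacks) :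
    TM2.step (program d) (config l r s) = some (stepAux (program d l) r s.fn) := rfl

/-! ### Construction of the quantified bits from the input -/

section Setup

variable {d : Bool} {B : ℕ} {c : MCfg}

theorem Reach.load (inp : List Letter) : ∀ (aux : List Letter) (cnt : List Bool) (r : Reg),
    r.tmp = {} → 2 * inp.length + aux.length + cnt.length ≤ B →
    Reach d B (config .copy { r with track := .w }
      { aux := inp.reverse ++ aux, cnt := List.replicate inp.length true ++ cnt }) c →
    Reach d B (config .load r { inp := inp, aux := aux, cnt := cnt }) c := by
  induction inp with
  | nil =>
    rintro aux cnt ⟨tmp, _, _, _, _, _, _⟩ hr hB hc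
    subst hr
    exact .step (by simp [program, stepAux])
      (by simp [Stacks.size] at hB ⊢; omega) hc
  | cons a inp ih =>
    rintro aux cnt ⟨tmp, _, _, _, _, _, _⟩ hr hB hc
    subst hr
    simp only [List.length_cons] at hB
    refine .step (by simp [program, stepAux] ; rfl)
      (by simp [Stacks.size]; omega) (ih _ _ _ rfl (by simp; omega) ?_)
    simpa [List.replicate_succ', List.append_assoc] using hc

theorem Reach.restore_loop (inp : List Letter) : ∀ (aux : List Letter) (todo : List Entry)
    (cnt : List Bool) (r : Reg), r.tmp = {} →
    inp.length + aux.length + todo.length + cnt.length ≤ B →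
    Reach d B (config .restore r { aux := inp.reverse ++ aux, todo := todo, cnt := cnt }) c →
    Reach d B (config .restore r { inp := inp, aux := aux, todo := todo, cnt := cnt }) c := by
  induction inp with
  | nil => intro aux todo cnt r _ _ hc; exact hc
  | cons a inp ih =>
    rintro aux todo cnt ⟨tmp, _, _, _, _, _, _⟩ hr hB hc
    subst hr
    simp only [List.length_cons] at hB
    refine .step (by simp [program, stepAux] ; rfl)
      (by simp [Stacks.size]; omega) (ih _ _ _ _ rfl (by simp; omega) ?_)
    simpa [List.append_assoc] using hc

theorem Reach.copy_loop (aux : List Letter) : ∀ (inp : List Letter) (todo : List Entry)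
    (cnt : List Bool) (r : Reg), r.tmp = {} →
    inp.length + 2 * aux.length + todo.length + cnt.length ≤ B →
    Reach d B (config .restore r
      { inp := aux.reverse ++ inp, todo := blankBlock r.track aux.reverse ++ todo, cnt := cnt }) c →
    Reach d B (config .copy r { inp := inp, aux := aux, todo := todo, cnt := cnt }) c := by
  induction aux with
  | nil =>
    rintro inp todo cnt ⟨tmp, _, _, _, _, _, _⟩ hr hB hc
    subst hr
    exact .step (by simp [program, stepAux] ; rfl)
      (by simp [Stacks.size, blankBlock] at hB ⊢; omega) hc
  | cons a aux ih =>
    rintro inp todo cnt ⟨tmp, _, _, _, _, _, _⟩ hr hB hc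
    subst hr
    simp only [List.length_cons] at hB
    refine .step (by simp [program, stepAux] ; rfl)
      (by simp [Stacks.size]; omega) (ih _ _ _ _ rfl (by simp; omega) ?_)
    simpa [List.append_assoc, blankBlock] using hc

theorem Reach.block (w : List Letter) (todo : List Entry) (cnt : List Bool) (r : Reg)
    (hr : r.tmp = {}) (hB : 2 * w.length + todo.length + cnt.length ≤ B)
    (hc : Reach d B (config .restore r
      { aux := w.reverse, todo := blankBlock r.track w ++ todo, cnt := cnt }) c) :
    Reach d B (config .copy r { aux := w.reverse, todo := todo, cnt := cnt }) c := by
  refine .copy_loop _ _ _ _ _ hr (by simp; omega) (.restore_loop _ _ _ _ _ hr ?_ ?_)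
  · simp [blankBlock]; omega
  · simpa using hc

theorem Reach.count (w : List Letter) (k : ℕ) : ∀ (j : ℕ) (r : Reg), r.tmp = {} →
    2 * w.length + (template w (j + k)).length + k ≤ B →
    (∀ r', r'.tmp = {} → Reach d B (config .clear r'
      { aux := w.reverse, todo := template w (j + k) }) c) →
    Reach d B (config .count r
      { aux := w.reverse, todo := template w j, cnt := List.replicate k true }) c := by
  induction k with
  | zero =>
    rintro j ⟨tmp, _, _, _, _, _, _⟩ hr hB hc
    subst hr
    exact .step (by simp [program, stepAux] ; rfl)
      (by simp [Stacks.size] at hB ⊢; omega) (hc _ rfl)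
  | succ k ih =>
    rintro j ⟨tmp, _, _, _, _, _, _⟩ hr hB hc
    subst hr
    have hlen : ∀ i, (template w i).length ≤ (template w (i + 1)).length := by
      intro i; simp [template]; omega
    have hmono : (template w (j + 1)).length ≤ (template w (j + (k + 1))).length :=
      monotone_nat_of_le_succ (f := fun i => (template w i).length) hlen (by omega)
    have h1 : (template w (j + 1)).length = (template w j).length + 4 * w.length + 1 := by
      simp [template, blankBlock]; omega
    refine .step (by simp [program, stepAux, List.replicate_succ] ; rfl)
      (by simp [Stacks.size]; omega) ?_
    -- One round is stacked from its end: the blocks `z`, `y`, `x`, `u`, and then the mark.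
    refine .block _ _ _ _ rfl (by simp; omega) ?_
    refine .step (by simp [program, stepAux, Track.toNat, Track.pred] ; rfl)
      (by simp [Stacks.size, blankBlock]; omega) ?_
    refine .block _ _ _ _ rfl (by simp [blankBlock]; omega) ?_
    refine .step (by simp [program, stepAux, Track.toNat, Track.pred] ; rfl)
      (by simp [Stacks.size, blankBlock]; omega) ?_
    refine .block _ _ _ _ rfl (by simp [blankBlock]; omega) ?_
    refine .step (by simp [program, stepAux, Track.toNat, Track.pred] ; rfl)
      (by simp [Stacks.size, blankBlock]; omega) ?_
    refine .block _ _ _ _ rfl (by simp [blankBlock]; omega) ?_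
    refine .step (by simp [program, stepAux, Track.toNat, Track.pred] ; rfl)
      (by simp [Stacks.size, blankBlock]; omega) ?_
    refine ih (j + 1) _ rfl ?_ ?_
    · rw [show j + 1 + k = j + (k + 1) by omega]; omega
    · rw [show j + 1 + k = j + (k + 1) by omega]; exact hc

theorem Reach.clear (aux : List Letter) : ∀ (todo : List Entry) (r : Reg), r.tmp = {} →
    aux.length + todo.length ≤ B →
    Reach d B (config .down r { todo := todo }) c →
    Reach d B (config .clear r { aux := aux, todo := todo }) c := by
  induction aux with
  | nil =>
    rintro todo ⟨tmp, _, _, _, _, _, _⟩ hr hB hc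
    subst hr
    exact .step (by simp [program, stepAux])
      (by simp [Stacks.size] at hB ⊢; omega) hc
  | cons a aux ih =>
    rintro todo ⟨tmp, _, _, _, _, _, _⟩ hr hB hc
    subst hr
    simp only [List.length_cons] at hB
    exact .step (by simp [program, stepAux])
      (by simp [Stacks.size]; omega) (ih _ _ rfl (by omega) hc)

theorem Reach.setup (w : List Letter)
    (hB : 3 * w.length + (template w w.length).length ≤ B)
    (hc : ∀ r', r'.tmp = {} →
      Reach d B (config .down r' { todo := template w w.length }) c) :
    Reach d B (config .load {} { inp := w }) c := by
  have hmono : (template w 0).length ≤ (template w w.length).length :=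
    monotone_nat_of_le_succ (f := fun i => (template w i).length)
      (fun i => by simp [template]; omega) (by omega)
  have h0 : (template w 0).length = w.length := by simp [template, blankBlock]
  refine .load w [] [] {} rfl (by simp; omega) ?_
  simp only [List.append_nil]
  refine .block _ _ _ _ rfl (by simp; omega) ?_
  refine .step (by simp [program, stepAux, Track.toNat, Track.pred] ; rfl)
    (by simp [Stacks.size, blankBlock]; omega) ?_
  refine .count w w.length 0 _ rfl (by rw [Nat.zero_add]; omega) fun r' hr' => ?_
  rw [Nat.zero_add]
  exact .clear _ _ _ hr' (by simp; omega) (hc r' hr')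

end Setup

/-! ### Checking one round on the machine -/

section Round

variable {d : Bool} {B : ℕ} {c : MCfg}

theorem Reach.zip_loop (todo done : List Entry) (T : List (Letter × Bool)) :
    ∀ (X Y Z U : List Bool) (zip : List Cell) (name : List Bool) (r : Reg), r.tmp = {} →
    todo.length + done.length + 2 * T.length + X.length + Y.length + Z.length + U.length +
      zip.length + name.length ≤ B →
    Reach d B (config .scan r
      { todo := todo, done := done, X := X.drop T.length, Y := Y.drop T.length,
        Z := Z.drop T.length, U := U.drop T.length, zip := (zipCells T X Y Z U).reverse ++ zip,
        name := ((zipCells T X Y Z U).filterMap Cell.digit).reverse ++ name }) c →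
    Reach d B (config .zip r
      { todo := todo, done := done, T := T, X := X, Y := Y, Z := Z, U := U, zip := zip,
        name := name }) c := by
  induction T with
  | nil =>
    rintro X Y Z U zip name ⟨tmp, _, _, _, _, _, _⟩ hr hB hc
    subst hr
    exact .step (by simp [program, stepAux]; rfl)
      (by simp [Stacks.size, zipCells] at hB ⊢; omega) hc
  | cons a T ih =>
    rintro X Y Z U zip name ⟨tmp, _, _, _, _, _, _⟩ hr hB hc
    subst hr
    simp only [List.length_cons] at hB
    have hX := X.length_tail
    have hY := Y.length_tail
    have hZ := Z.length_tail
    have hU := U.length_tail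
    cases hd : Cell.digit ⟨a.1, a.2, X.head?.getD false, Y.head?.getD false, Z.head?.getD false,
      U.head?.getD false⟩ with
    | none =>
      refine .step (by simp [program, stepAux, hd]; rfl)
        (by simp [Stacks.size]; omega) (ih _ _ _ _ _ _ _ rfl (by simp; omega) ?_)
      simpa [zipCells, hd, List.filterMap_cons] using hc
    | some b =>
      refine .step (by simp [program, stepAux, hd]; rfl)
        (by simp [Stacks.size]; omega) (ih _ _ _ _ _ _ _ rfl (by simp; omega) ?_)
      simpa [zipCells, hd, List.filterMap_cons] using hc

theorem step_scan (todo done : List Entry) (X Y Z U : List Bool) (e : Cell) (cs : List Cell)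
    (s : Scan) (r : Reg) (hr : r.tmp = {}) (hs : r.flags = s.acc) :
    TM2.step (program d) (config .scan r
      { todo := todo, done := done, X := X, Y := Y, Z := Z, U := U, zip := e :: cs,
        val := s.val, name := s.name }) =
    some (config .scan { r with flags := (s.step e).acc }
      { todo := todo, done := done, X := X, Y := Y, Z := Z, U := e.t :: U, zip := cs,
        val := (s.step e).val, name := (s.step e).name }) := by
  obtain ⟨tmp, _, f, _, _, _, _⟩ := r
  obtain ⟨a, v, n⟩ := s
  obtain ⟨l, t, x, y, z, u⟩ := e
  dsimp only at hr hs
  subst hr hs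
  have hv : ∀ v : List (Bool × Bool), v.tail.tail = v.drop 2 := fun v => by cases v <;> simp
  cases l
  case bit =>
    cases h : f.active <;>
    simp [program, stepAux, scanTail, Scan.step, Letter.isBit, h, Letter.isBinary,
      Letter.isUnaryOrBinary, Letter.arity, Reg.updateFlags, Flags.update]
  case' bot | neg | and | cond | var =>
    simp [program, stepAux, scanTail, Scan.step, Letter.isBit, Letter.isBinary,
      Letter.isUnaryOrBinary, Letter.arity, Reg.updateFlags, Flags.update, hv]
  all_goals rfl

theorem Scan.length_step_val (e : Cell) (s : Scan) :
    (s.step e).val.length ≤ s.val.length + 1 := by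
  simp only [Scan.step]
  split <;> simp

theorem Scan.length_step_name (e : Cell) (s : Scan) :
    (s.step e).name.length ≤ s.name.length := by
  simp only [Scan.step]
  split <;> simp

theorem Scan.length_foldr_val (cs : List Cell) (s : Scan) :
    (cs.foldr Scan.step s).val.length ≤ cs.length + s.val.length := by
  induction cs with
  | nil => simp
  | cons e cs ih =>
    have := (cs.foldr Scan.step s).length_step_val e
    simp only [List.foldr_cons, List.length_cons]
    omega

theorem Scan.length_foldr_name (cs : List Cell) (s : Scan) :
    (cs.foldr Scan.step s).name.length ≤ s.name.length := by
  induction cs with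
  | nil => simp
  | cons e cs ih => exact (Scan.length_step_name _ _).trans ih

/-- A consumed cell adds one symbol to `U` and at most one to `val`, which the term `2 * cs.length`
pays for. -/
theorem Reach.scan_loop (todo done : List Entry) (X Y Z : List Bool) (cs : List Cell) :
    ∀ (U : List Bool) (s : Scan) (r : Reg), r.tmp = {} → r.flags = s.acc →
    todo.length + done.length + X.length + Y.length + Z.length + U.length + 2 * cs.length +
      s.val.length + s.name.length ≤ B →
    (∀ s', s' = cs.foldl (fun s e => s.step e) s →
      Reach d B (config .scan { r with flags := s'.acc }
        { todo := todo, done := done, X := X, Y := Y, Z := Z,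
          U := (cs.map Cell.t).reverse ++ U, val := s'.val, name := s'.name }) c) →
    Reach d B (config .scan r
      { todo := todo, done := done, X := X, Y := Y, Z := Z, U := U, zip := cs,
        val := s.val, name := s.name }) c := by
  induction cs with
  | nil =>
    intro U s r hr hs hB hc
    have h := hc s rfl
    rwa [← hs] at h
  | cons e cs ih =>
    intro U s r hr hs hB hc
    simp only [List.length_cons] at hB
    have h1 := s.length_step_val e
    have h2 := s.length_step_name e
    refine .step (step_scan _ _ _ _ _ _ _ _ _ _ hr hs) (by simp [Stacks.size]; omega)
      (ih _ _ _ hr rfl (by simp; omega) fun s' hs' => ?_)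
    simpa using hc s' hs'

theorem Reach.clearName_loop (todo done : List Entry) (X Y Z U name : List Bool) :
    ∀ r : Reg, r.tmp = {} →
    todo.length + done.length + X.length + Y.length + Z.length + U.length + name.length ≤ B →
    Reach d B (config .leaf r { todo := todo, done := done, X := X, Y := Y, Z := Z, U := U }) c →
    Reach d B (config .clearName r
      { todo := todo, done := done, X := X, Y := Y, Z := Z, U := U, name := name }) c := by
  induction name with
  | nil =>
    rintro ⟨tmp, _, _, _, _, _, _⟩ hr hB hc
    subst hr
    exact .step (by simp [program, stepAux]) (by simp [Stacks.size] at hB ⊢; omega) hc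
  | cons a name ih =>
    rintro ⟨tmp, _, _, _, _, _, _⟩ hr hB hc
    subst hr
    simp only [List.length_cons] at hB
    exact .step (by simp [program, stepAux]) (by simp [Stacks.size]; omega)
      (ih _ rfl (by omega) hc)

theorem Reach.clearVal_loop (todo done : List Entry) (X Y Z U name : List Bool)
    (val : List (Bool × Bool)) : ∀ r : Reg, r.tmp = {} →
    todo.length + done.length + X.length + Y.length + Z.length + U.length + name.length +
      val.length ≤ B →
    Reach d B (config .leaf r { todo := todo, done := done, X := X, Y := Y, Z := Z, U := U }) c →
    Reach d B (config .clearVal r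
      { todo := todo, done := done, X := X, Y := Y, Z := Z, U := U, name := name, val := val })
      c := by
  induction val with
  | nil =>
    rintro ⟨tmp, _, _, _, _, _, _⟩ hr hB hc
    subst hr
    simp only [List.length_nil, add_zero] at hB
    exact .step (by simp [program, stepAux]) (by simp [Stacks.size] at hB ⊢; omega)
      (.clearName_loop _ _ _ _ _ _ _ _ rfl hB hc)
  | cons a val ih =>
    rintro ⟨tmp, _, _, _, _, _, _⟩ hr hB hc
    subst hr
    simp only [List.length_cons] at hB
    exact .step (by simp [program, stepAux]) (by simp [Stacks.size]; omega)
      (ih _ rfl (by omega) hc)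

/-- The stacks that hold the state of the evaluation of a play. -/
def Leaf.stacks (s : Leaf) (todo done : List Entry) : Stacks :=
  { todo := todo, done := done, T := s.T, X := s.X, Y := s.Y, Z := s.Z, U := s.U }

/-- The registers hold the state of the evaluation of a play. -/
structure Reg.Holds (r : Reg) (s : Leaf) : Prop where
  tmp : r.tmp = {}
  good : r.good = s.good
  wf : r.wf = s.wf
  root : r.root = s.root

def Leaf.size (s : Leaf) : ℕ :=
  s.T.length + s.X.length + s.Y.length + s.Z.length + s.U.length

theorem Leaf.size_stacks (s : Leaf) (todo done : List Entry) :
    (s.stacks todo done).size = todo.length + done.length + s.size := by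
  simp [Stacks.size, Leaf.stacks, Leaf.size]
  omega

theorem length_zipCells (T : List (Letter × Bool)) : ∀ X Y Z U : List Bool,
    (zipCells T X Y Z U).length = T.length := by
  induction T with
  | nil => intros; rfl
  | cons a T ih => intro X Y Z U; simp [zipCells, ih]

theorem map_t_zipCells (T : List (Letter × Bool)) : ∀ X Y Z U : List Bool,
    (zipCells T X Y Z U).map Cell.t = T.map Prod.snd := by
  induction T with
  | nil => intros; rfl
  | cons a T ih => intro X Y Z U; simp [zipCells, ih]

/-- The factor 4 leaves room, besides the blocks, for the zipped cells, the digits of the name and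
the label stack, each at most as long as `s.T`. -/
theorem Reach.round (todo done : List Entry) (s : Leaf) (e : Entry) (he : e.track = .mark)
    (r : Reg) (hr : r.Holds s) (hf : r.flags = .init)
    (hB : todo.length + done.length + 4 * s.size ≤ B)
    (hc : ∀ r' : Reg, r'.Holds (s.step d e) →
      Reach d B (config .leaf r' ((s.step d e).stacks todo done)) c) :
    Reach d B (config .zip r (s.stacks todo done)) c := by
  obtain ⟨h1, h2, h3, h4⟩ := hr
  simp only [Leaf.size] at hB
  have hl : (zipCells s.T s.X s.Y s.Z s.U).length = s.T.length := length_zipCells _ _ _ _ _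
  have hn : ((zipCells s.T s.X s.Y s.Z s.U).filterMap Cell.digit).length ≤ s.T.length :=
    hl ▸ List.length_filterMap_le _ _
  refine .zip_loop _ _ _ _ _ _ _ _ _ _ h1 (by simp; omega) ?_
  simp only [List.append_nil]
  refine .scan_loop _ _ _ _ _ _ _ ⟨.init, [], _⟩ _ h1 hf (by simp [hl]; omega)
    fun s' hs' => ?_
  rw [List.foldl_reverse] at hs'
  have hs2 : s' = scanCells s.cells := hs'
  have hv : s'.val.length ≤ s.T.length := by
    have := Scan.length_foldr_val s.cells ⟨.init, [], (s.cells.filterMap Cell.digit).reverse⟩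
    rw [hs2]
    exact this.trans hl.le
  have hm : s'.name.length ≤ s.T.length := by
    have := Scan.length_foldr_name s.cells ⟨.init, [], (s.cells.filterMap Cell.digit).reverse⟩
    rw [hs2]
    exact this.trans (by rw [List.length_reverse]; exact hn)
  rw [List.map_reverse, List.reverse_reverse, map_t_zipCells]
  -- The single transition taken once `zip` is empty; it computes the verdict of the round.
  have hstep : ∃ r' : Reg, r'.Holds (s.step d e) ∧ ∀ X Y Z U : List Bool,
      TM2.step (program d) (config .scan { r with flags := s'.acc }
        { todo := todo, done := done, X := X, Y := Y, Z := Z, U := U, val := s'.val,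
          name := s'.name }) =
      some (config .clearVal r'
        { todo := todo, done := done, X := X, Y := Y, Z := Z, U := U, val := s'.val.drop 2,
          name := s'.name.tail }) := by
    obtain ⟨a, v, n⟩ := s'
    obtain ⟨tmp, k, f, _, _, _, b⟩ := r
    dsimp only at h1 h2 h3 h4 hf
    subst h1 h2 h3 h4 hf
    refine ⟨⟨{}, k, a, s.good && a.verdict d n.isEmpty, a.wf && (v.length == 1),
      (v.head?.getD (false, false)).1, b⟩, ⟨rfl, ?_, ?_, ?_⟩, ?_⟩
    · simp [Leaf.step, he, ← hs2]
    · simp [Leaf.step, he, ← hs2]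
    · simp [Leaf.step, he, ← hs2]
    · intro X Y Z U
      rcases v with _ | ⟨p, _ | ⟨q, v⟩⟩ <;> rcases n with _ | ⟨b, n⟩ <;>
        simp [program, stepAux, Reg.finishRound]
  obtain ⟨r', hr', hstep⟩ := hstep
  refine .step (hstep _ _ _ _) (by simp [Stacks.size]; omega)
    (.clearVal_loop _ _ _ _ _ _ _ _ _ hr'.tmp (by simp; omega) ?_)
  have := hc r' hr'
  simpa [Leaf.stacks, Leaf.step, he] using this

end Round

/-! ### Depth-first evaluation of the game -/

section Search

variable {d : Bool} {B : ℕ} {c : MCfg}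

theorem Leaf.size_step (s : Leaf) (e : Entry) : (s.step d e).size ≤ s.size + 1 := by
  obtain ⟨k, a, b⟩ := e
  cases k <;> simp [Leaf.step, Leaf.size] <;> omega

/-- The quantity bounded by `B` never grows: an entry moved from `done` to `todo` frees 5, costs 1
there and at most 4 through `s.size`. -/
theorem Reach.leaf_loop (done : List Entry) : ∀ (todo : List Entry) (s : Leaf) (r : Reg),
    r.Holds s → todo.length + 5 * done.length + 4 * s.size ≤ B →
    (∀ r' : Reg, r'.Holds (done.foldl (Leaf.step d) s) →
      Reach d B (config .wipe r'
        ((done.foldl (Leaf.step d) s).stacks (done.reverse ++ todo) [])) c) →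
    Reach d B (config .leaf r (s.stacks todo done)) c := by
  induction done with
  | nil =>
    rintro todo s ⟨tmp, _, _, _, _, _, _⟩ hr hB hc
    obtain rfl := hr.tmp
    exact .step (by simp [program, stepAux, Leaf.stacks])
      (by simp [Leaf.size_stacks] at hB ⊢; omega) (hc _ hr)
  | cons e done ih =>
    rintro todo s ⟨tmp, k, f, g, w, ρ, b⟩ ⟨h1, h2, h3, h4⟩ hB hc
    dsimp only at h1 h2 h3 h4
    subst h1 h2 h3 h4
    simp only [List.length_cons] at hB
    have hsize := s.size_step (d := d) e
    have key : ∀ r' : Reg, r'.Holds (s.step d e) →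
        Reach d B (config .leaf r' ((s.step d e).stacks (e :: todo) done)) c :=
      fun r' hr' => ih _ _ _ hr' (by simp; omega) fun r'' hr'' => by
        simpa using hc r'' hr''
    obtain ⟨t, a, i⟩ := e
    cases t
    case mark =>
      refine .step (s' := s.stacks (⟨.mark, a, i⟩ :: todo) done)
        (by simp [program, stepAux, Leaf.stacks, Track.toNat]; rfl)
        (by simp [Leaf.size_stacks]; omega)
        (.round _ _ s ⟨.mark, a, i⟩ rfl _ ⟨rfl, rfl, rfl, rfl⟩ rfl (by simp; omega) key)
    all_goals
      refine .step (by simp [program, stepAux, Leaf.stacks, Track.toNat]; rfl)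
        (by simp [Leaf.size_stacks]; omega)
        (key ⟨{}, _, _, _, _, _, _⟩ ⟨rfl, rfl, rfl, rfl⟩)

theorem Reach.wipe_loop (n : ℕ) : ∀ (todo : List Entry) (s : Leaf) (r : Reg), r.Holds s →
    s.size ≤ n → todo.length + s.size ≤ B →
    (∀ r' : Reg, r'.tmp = {} → r'.value = s.verdict →
      Reach d B (config .rest r' { todo := todo }) c) →
    Reach d B (config .wipe r (s.stacks todo [])) c := by
  induction n with
  | zero =>
    rintro todo ⟨T, X, Y, Z, U, _, _, _⟩ ⟨tmp, _, _, _, _, _, _⟩ ⟨h1, h2, h3, h4⟩ hn hB hc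
    dsimp only at h1 h2 h3 h4
    subst h1 h2 h3 h4
    simp [Leaf.size, List.length_eq_zero_iff] at hn
    obtain ⟨⟨⟨⟨rfl, rfl⟩, rfl⟩, rfl⟩, rfl⟩ := hn
    exact .step (by simp [program, stepAux, Leaf.stacks]; rfl)
      (by simp [Stacks.size, Leaf.size] at hB ⊢; omega) (hc _ rfl rfl)
  | succ n ih =>
    rintro todo s ⟨tmp, _, _, _, _, _, _⟩ hr hn hB hc
    obtain rfl := hr.tmp
    by_cases h0 : s.size = 0
    · exact ih todo s _ hr (by omega) hB hc
    obtain ⟨T, X, Y, Z, U, g, w, ρ⟩ := s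
    have hs : (T.head?.isSome || X.head?.isSome || Y.head?.isSome || Z.head?.isSome ||
        U.head?.isSome) = true := by
      simp only [Leaf.size] at h0
      cases T <;> cases X <;> cases Y <;> cases Z <;> cases U <;> simp at h0 ⊢
    have hsize : (Leaf.mk T.tail X.tail Y.tail Z.tail U.tail g w ρ).size <
        (Leaf.mk T X Y Z U g w ρ).size := by
      simp only [Leaf.size, List.length_tail] at h0 ⊢
      omega
    refine .step (s' := (Leaf.mk T.tail X.tail Y.tail Z.tail U.tail g w ρ).stacks todo [])
      (by simp only [program, stepAux, step_config, Leaf.stacks]; simp [hs])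
      (by simp [Leaf.size_stacks]; omega)
      (ih _ _ ⟨{}, _, _, _, _, _, _⟩ ⟨rfl, hr.good, hr.wf, hr.root⟩ (by omega) (by omega) hc)

theorem Reach.rest_loop (todo : List Entry) : ∀ (done : List Entry) (r : Reg), r.tmp = {} →
    todo.length + done.length ≤ B →
    Reach d B (config .up r { done := todo.reverse ++ done }) c →
    Reach d B (config .rest r { todo := todo, done := done }) c := by
  induction todo with
  | nil =>
    rintro done ⟨tmp, _, _, _, _, _, _⟩ hr hB hc
    subst hr
    exact .step (by simp [program, stepAux]) (by simp [Stacks.size] at hB ⊢; omega) hc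
  | cons e todo ih =>
    rintro done ⟨tmp, _, _, _, _, _, _⟩ hr hB hc
    subst hr
    simp only [List.length_cons] at hB
    refine .step (by simp [program, stepAux]; rfl) (by simp [Stacks.size]; omega)
      (ih _ _ rfl (by simp; omega) ?_)
    simpa using hc

theorem Leaf.size_foldl (done : List Entry) : ∀ s : Leaf,
    (done.foldl (Leaf.step d) s).size ≤ s.size + done.length := by
  induction done with
  | nil => intro s; simp
  | cons e done ih =>
    intro s
    have h1 := ih (s.step d e)
    have h2 := s.size_step (d := d) e
    simp only [List.foldl_cons, List.length_cons]
    omega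

theorem Reach.leaf (done : List Entry) (r : Reg) (hr : r.Holds .init)
    (hB : 5 * done.length ≤ B)
    (hc : ∀ r' : Reg, r'.tmp = {} → r'.value = leafVerdict d done →
      Reach d B (config .up r' { done := done }) c) :
    Reach d B (config .leaf r { done := done }) c := by
  have h0 : Leaf.init.size = 0 := rfl
  have h1 := Leaf.size_foldl (d := d) done .init
  refine .leaf_loop done [] .init r hr (by simp [h0]; omega) fun r' hr' => ?_
  refine .wipe_loop _ _ _ _ hr' le_rfl (by simp; omega) fun r'' hr'' hv => ?_
  refine .rest_loop _ _ _ hr'' (by simp; omega) ?_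
  simpa using hc r'' hr'' hv

/-- Induction on the undecided bits. Each branch returns with `todo` and `done` restored, so the
second reuses the space of the first. -/
theorem Reach.search (todo : List Entry) : ∀ (done : List Entry) (r : Reg), r.tmp = {} →
    (∀ e ∈ todo, e.bit = false) → 5 * (todo.length + done.length) ≤ B →
    (∀ r' : Reg, r'.tmp = {} → r'.value = game (leafVerdict d) todo done →
      Reach d B (config .up r' { todo := todo, done := done }) c) →
    Reach d B (config .down r { todo := todo, done := done }) c := by
  induction todo with
  | nil =>
    rintro done ⟨tmp, _, _, _, _, _, _⟩ hr _ hB hc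
    subst hr
    simp only [List.length_nil, Nat.zero_add] at hB
    exact .step (by simp [program, stepAux]; rfl) (by simp [Stacks.size]; omega)
      (.leaf _ _ ⟨rfl, rfl, rfl, rfl⟩ hB hc)
  | cons e todo ih =>
    rintro done ⟨tmp, _, _, _, _, _, _⟩ hr he hB hc
    subst hr
    obtain ⟨t, a, i⟩ := e
    obtain rfl : i = false := he _ (List.mem_cons_self ..)
    have he' : ∀ e ∈ todo, e.bit = false := fun e h => he e (List.mem_cons_of_mem _ h)
    simp only [List.length_cons] at hB
    refine .step (by simp [program, stepAux]; rfl) (by simp [Stacks.size]; omega)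
      (ih _ _ rfl he' (by simp; omega) ?_)
    rintro ⟨tmp, k, f, g, w, ρ, v⟩ hr hv
    dsimp only at hr hv
    subst hr
    -- Equality means that the first branch decides: true for an existential bit, false for a
    -- universal one. Otherwise the value of the second branch is the value of the node.
    by_cases hx : t.isExists = v
    · refine .step (by simp [program, stepAux, hx]; rfl) (by simp [Stacks.size]; omega)
        (hc _ rfl ?_)
      cases v <;> simp [game, hx, ← hv]
    · refine .step (by simp [program, stepAux, bne_iff_ne.2 hx]; rfl) (by simp [Stacks.size]; omega)
        (ih _ _ rfl he' (by simp; omega) ?_)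
      rintro ⟨tmp, k, f, g, w, ρ, v'⟩ hr hv'
      dsimp only at hr hv'
      subst hr
      refine .step (by simp [program, stepAux]; rfl) (by simp [Stacks.size]; omega)
        (hc _ rfl ?_)
      cases v <;> simp at hx <;> simp [game, hx, ← hv, ← hv']

theorem Reach.fin_loop (todo : List Entry) : ∀ r : Reg, r.tmp = {} → todo.length + 1 ≤ B →
    Reach d B ⟨none, {}, ({ out := [!r.value] } : Stacks).fn⟩ c →
    Reach d B (config .fin r { todo := todo }) c := by
  induction todo with
  | nil =>
    rintro ⟨tmp, _, _, _, _, _, _⟩ hr hB hc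
    subst hr
    refine .head ⟨?_, ?_⟩ hc
    · simp [program, stepAux]
    · rw [Stacks.sum_length_fn]; simpa [Stacks.size] using hB
  | cons e todo ih =>
    rintro ⟨tmp, _, _, _, _, _, _⟩ hr hB hc
    subst hr
    simp only [List.length_cons] at hB
    exact .step (by simp [program, stepAux]) (by simp [Stacks.size]; omega)
      (ih _ rfl (by omega) hc)

end Search

theorem length_template (w : List Letter) (k : ℕ) :
    (template w k).length = k * (4 * w.length + 1) + w.length := by
  induction k with
  | zero => simp [template, blankBlock]
  | succ k ih => simp [template, blankBlock, ih, Nat.succ_mul]; omega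

theorem bit_of_mem_template (w : List Letter) (k : ℕ) : ∀ e ∈ template w k, e.bit = false := by
  induction k with
  | zero => simp [template, blankBlock]
  | succ k ih =>
    intro e he
    simp only [template, blankBlock, List.mem_cons, List.mem_append, List.mem_map] at he
    rcases he with rfl | ⟨a, -, rfl⟩ | ⟨a, -, rfl⟩ | ⟨a, -, rfl⟩ | ⟨a, -, rfl⟩ | he
    all_goals first | rfl | exact ih e he

/-- The space that suffices for inputs of length `n`. -/
def spaceBound (n : ℕ) : ℕ := 5 * (n * (4 * n + 1) + n) + 3 * n + 1

theorem Reach.halts (d : Bool) (w : List Letter) :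
    Reach d (spaceBound w.length) (config .load {} { inp := w })
      ⟨none, {}, ({ out := [!game (leafVerdict d) (template w w.length) []] } : Stacks).fn⟩ := by
  have h := length_template w w.length
  have hB : spaceBound w.length = 5 * (template w w.length).length + 3 * w.length + 1 := by
    rw [h, spaceBound]
  rw [hB]
  refine .setup w (by omega) fun r' hr' => ?_
  refine .search _ _ _ hr' (bit_of_mem_template w _) (by simp; omega) ?_
  rintro ⟨tmp, _, _, _, _, _, _⟩ hr hv
  subst hr
  refine .step (by simp [program, stepAux]; rfl) (by simp [Stacks.size]; omega)
    (.fin_loop _ _ rfl (by omega) ?_)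
  rw [hv]
  exact .refl

/-! ### The language is in polynomial space -/

instance : Finite Letter :=
  Finite.of_injective (β := Option (Option (Option (Option (Option Bool)))))
    (fun
      | .bot => none
      | .neg => some none
      | .and => some (some none)
      | .cond => some (some (some none))
      | .var => some (some (some (some none)))
      | .bit b => some (some (some (some (some b)))))
    (by rintro (_ | _ | _ | _ | _ | _) (_ | _ | _ | _ | _ | _) h <;> simp_all)

instance : Finite Track :=
  Finite.of_injective (β := Fin 6) (fun k => ⟨k.toNat, by cases k <;> decide⟩)
    (by intro a b h; cases a <;> cases b <;> simp [Track.toNat] at h ⊢)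

instance : Finite Entry :=
  Finite.of_injective (fun e => (e.track, e.letter, e.bit))
    (by rintro ⟨_, _, _⟩ ⟨_, _, _⟩ h; simpa using h)

instance : Finite Cell :=
  Finite.of_injective (fun e => (e.letter, e.t, e.x, e.y, e.z, e.u))
    (by rintro ⟨_, _, _, _, _, _⟩ ⟨_, _, _, _, _, _⟩ h; simpa using h)

instance : Finite Flags :=
  Finite.of_injective (fun a => (a.prev, a.wf, a.coherent, a.marked, a.refuted, a.successor,
      a.vacuous, a.claim, a.started, a.active, a.value, a.mismatch))
    (by
      rintro ⟨_, _, _, _, _, _, _, _, _, _, _, _⟩ ⟨_, _, _, _, _, _, _, _, _, _, _, _⟩ h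
      simpa using h)

instance : Finite Scratch :=
  Finite.of_injective (fun a => (a.letter, a.entry, a.typ, a.x, a.y, a.z, a.u, a.cell, a.p, a.q,
      a.digit))
    (by
      rintro ⟨_, _, _, _, _, _, _, _, _, _, _⟩ ⟨_, _, _, _, _, _, _, _, _, _, _⟩ h
      simpa using h)

instance : Finite Reg :=
  Finite.of_injective (fun a => (a.tmp, a.track, a.flags, a.good, a.wf, a.root, a.value))
    (by rintro ⟨_, _, _, _, _, _, _⟩ ⟨_, _, _, _, _, _, _⟩ h; simpa using h)

def Label.all : List Label :=
  [.load, .copy, .restore, .count, .clear, .down, .leaf, .zip, .scan, .clearVal, .clearName,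
    .wipe, .rest, .up, .fin]

instance : Finite Label :=
  Set.finite_univ_iff.1 ((List.finite_toSet Label.all).subset fun l _ => by
    cases l <;> simp [Label.all])

theorem StackName.finite_Γ (k : StackName) : Finite k.Γ := by
  cases k <;> dsimp only [StackName.Γ] <;> infer_instance

noncomputable def machine (d : Bool) : FinTM2 where
  K := StackName
  k₀ := .inp
  k₁ := .out
  Γ := StackName.Γ
  Λ := Label
  main := .load
  ΛFin := Fintype.ofFinite _
  σ := Reg
  initialState := {}
  σFin := Fintype.ofFinite _
  Γk₀Fin := Fintype.ofFinite _
  m := program d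

theorem initList_machine (d : Bool) (w : List Letter) :
    initList (machine d) w = config .load {} { inp := w } := by
  unfold initList config
  congr 1
  funext k
  cases k <;> rfl

theorem haltList_machine (d : Bool) (l : List Bool) :
    haltList (machine d) l = (⟨none, {}, ({ out := l } : Stacks).fn⟩ : MCfg) := by
  unfold haltList
  congr 1
  funext k
  cases k <;> rfl

theorem nonempty_evalsTo_of_reach {d : Bool} {B : ℕ} {a b : MCfg} (h : Reach d B a b) :
    Nonempty (StateTransition.EvalsTo (machine d).step a (some b)) := by
  induction h using Relation.ReflTransGen.head_induction_on with
  | refl => exact ⟨.refl _ _⟩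
  | head h _ ih =>
    obtain ⟨n, hn⟩ := ih
    exact ⟨⟨n + 1, by rw [Function.iterate_succ_apply, ← hn]; congr 1; exact h.1⟩⟩

/-- The machine is deterministic, so every configuration that occurs in a halting computation lies
on it. -/
theorem Reach.size_le {d : Bool} {B : ℕ} {a b c : MCfg} (h : Reach d B a b)
    (hb : TM2.step (program d) b = none) (ha : ∑ k, (a.stk k).length ≤ B)
    (hc : Relation.ReflTransGen (fun a b => b ∈ TM2.step (program d) a) a c) :
    ∑ k, (c.stk k).length ≤ B := by
  induction h using Relation.ReflTransGen.head_induction_on with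
  | refl =>
    rcases hc.cases_head with rfl | ⟨e, he, -⟩
    · exact ha
    · simp [hb] at he
  | head h _ ih =>
    rcases hc.cases_head with rfl | ⟨e, he, hec⟩
    · exact ha
    · rw [h.1] at he
      obtain rfl := Option.some.inj he
      exact ih h.2 hec

theorem machine_spec (d : Bool) (w : List Letter) :
    (∃ b : Bool, (b = true ↔ w ∈ provabilityProblem (condLogic d)) ∧
      Nonempty (TM2Outputs (machine d) w (some [b]))) ∧
    ∀ c : (machine d).Cfg, StateTransition.Reaches (machine d).step (initList (machine d) w) c →
      spaceUsed (machine d) c ≤ spaceBound w.length := by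
  have h := Reach.halts d w
  refine ⟨⟨!game (leafVerdict d) (template w w.length) [], ?_, ?_⟩, fun c hc => ?_⟩
  · rw [Bool.not_eq_true', game_template]
  · rw [← haltList_machine, ← initList_machine] at h
    exact nonempty_evalsTo_of_reach h
  · rw [initList_machine] at hc
    refine h.size_le (c := c) rfl ?_ hc
    rw [config, Stacks.sum_length_fn]
    simp [Stacks.size, spaceBound]
    omega

theorem inPSPACE_condLogic (d : Bool) : InPSPACE (provabilityProblem (condLogic d)) := by
  let X : Polynomial ℕ := Polynomial.X
  refine ⟨⟨machine d, .refl _, .refl _⟩, 5 * (X * (4 * X + 1) + X) + 3 * X + 1,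
    StackName.finite_Γ, fun w => ?_⟩
  have hp : (5 * (X * (4 * X + 1) + X) + 3 * X + 1 : Polynomial ℕ).eval w.length =
      spaceBound w.length := by simp [X, spaceBound]
  -- The machine's input is `w` mapped along the identity equivalence, which equals `w` only
  -- propositionally.
  have key : ∀ w' : List Letter, w' = w →
      (∃ b : Bool, (b = true ↔ w ∈ provabilityProblem (condLogic d)) ∧
        Nonempty (TM2Outputs (machine d) w' (some [b]))) ∧
      ∀ c : (machine d).Cfg, StateTransition.Reaches (machine d).step
        (initList (machine d) w') c → spaceUsed (machine d) c ≤ spaceBound w.length := by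
    rintro _ rfl
    exact machine_spec d _
  rw [hp]
  exact key _ (List.map_id w)

theorem mainTheorem10 :
    InPSPACE (provabilityProblem CKMPCEM) ∧ InPSPACE (provabilityProblem CKIDMPCEM) :=
  ⟨inPSPACE_condLogic false, inPSPACE_condLogic true⟩
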